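/- Let $\mathrm{SO}(3)$ carry its normalized Haar measure $\sigma$, and let $\|A\|_F=\sqrt{\operatorname{trace}(A^\top A)}$ be the Frobenius norm on $\mathbb{R}^{3\times 3}$. For $m\in\mathbb{N}=\{0,1,2,\dots\}$ and integers $-m\le k,l\le m$, let $\mathcal{D}^m_{k,l}:\mathrm{SO}(3)\to\mathbb{C}$ be the Wigner $\mathcal{D}$-functions, normalized in $L_2(\mathrm{SO}(3),\sigma)$: if $x=R_z(\alpha)R_y(\beta)R_z(\gamma)$ with Euler angles $\alpha,\gamma\in\mathbb{R}$, $\beta\in[0,\pi]$, then $$\mathcal{D}^m_{k,l}(x)=\sqrt{2m+1}\;e^{-ik\alpha}\,d^m_{k,l}(\beta)\,e^{-il\gamma},$$ $$d^m_{k,l}(\beta)=\sqrt{(m+k)!(m-k)!(m+l)!(m-l)!}\;\sum_s\frac{(-1)^{k-l+s}\cos(\tfrac{\beta}{2})^{2m+l-k-2s}\sin(\tfrac{\beta}{2})^{k-l+2s}}{(m+l-s)!\,s!\,(k-l+s)!\,(m-k-s)!},$$ the sum being over all integers $s$ for which the factorials have nonnegative arguments. Let $p>-3$. Then, for all $m\in\mathbb{N}$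 and $-m\le k,l\le m$, the integral $$a_m(p)=\iint_{\mathrm{SO}(3)\times\mathrm{SO}(3)}2^{-p/2}\|x-y\|_F^p\;\overline{\mathcal{D}^m_{k,l}(x)}\,\mathcal{D}^m_{k,l}(y)\,d\sigma(x)\,d\sigma(y)$$ converges absolutely, does not depend on $k,l$, and equals $$a_m(p)=\frac{2^p\,\Gamma(\frac p2+\frac32)}{\sqrt{\pi}\,\Gamma(-\frac p2)}\cdot\frac{\Gamma(-\frac p2+m)}{\Gamma(\frac p2+2+m)}\cdot\frac{1}{m+\frac12},$$ where for $p\in2\mathbb{N}$ the quotient $\Gamma(-\frac p2+m)/\Gamma(-\frac p2)$ is read as the Pochhammer symbol $(-\frac p2)_m=\prod_{i=0}^{m-1}(-\frac p2+i)$. In particular, if $p\notin2\mathbb{N}$, then $$|a_m(p)|=\left|\frac{2^p\,\Gamma(\frac p2+\frac32)}{\sqrt{\pi}\,\Gamma(-\frac p2)}\right|m^{-(p+3)}(1+o(1)),\qquad m\to\infty.$$ If $p\in2\mathbb{N}$, then the Fourier expansion of the kernel terminates: $a_m(p)=0$ for all $m>\frac p2$, and $$2^{-p/2}\|x-y\|_F^p=\sum_{m=0}^{p/2}a_m(p)\sum_{k,l=-m}^m\mathcal{D}^m_{k,l}(x)\overline{\mathcal{D}^m_{k,l}(y)},\qquad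 x,y\in\mathrm{SO}(3)$$ (with $0^0=1$ when $p=0$). -/

import Mathlib

open MeasureTheory Filter Topology

namespace WignerSO3

/-- The rotation group `SO(3)`, with the topology induced from `ℝ^{3×3}`. -/
abbrev SO3 : Type := ↥(Matrix.specialOrthogonalGroup (Fin 3) ℝ)

theorem transpose_mul_self (x : SO3) : x.1.transpose * x.1 = 1 :=
  (Matrix.mem_orthogonalGroup_iff' _ _).1 (Matrix.mem_specialOrthogonalGroup_iff.1 x.2).1

theorem det_eq_one (x : SO3) : x.1.det = 1 :=
  (Matrix.mem_specialOrthogonalGroup_iff.1 x.2).2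

theorem mem_SO3_iff {A : Matrix (Fin 3) (Fin 3) ℝ} :
    A ∈ Matrix.specialOrthogonalGroup (Fin 3) ℝ ↔ A.transpose * A = 1 ∧ A.det = 1 := by
  rw [Matrix.mem_specialOrthogonalGroup_iff, Matrix.mem_orthogonalGroup_iff']

instance : IsTopologicalGroup SO3 where
  continuous_inv := by
    refine Continuous.subtype_mk (f := fun x : SO3 => x.1.transpose) ?_ _
    exact Continuous.matrix_transpose continuous_subtype_val

instance : CompactSpace SO3 := by
  refine isCompact_iff_compactSpace.1 ?_
  have hK : IsCompact (Set.pi Set.univ fun _ : Fin 3 => Set.pi Set.univ fun _ : Fin 3 =>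
      Set.Icc (-1 : ℝ) 1) :=
    isCompact_univ_pi fun _ => isCompact_univ_pi fun _ => isCompact_Icc
  have hset : (Matrix.specialOrthogonalGroup (Fin 3) ℝ : Set (Matrix (Fin 3) (Fin 3) ℝ)) =
      {A | A.transpose * A = 1} ∩ {A | A.det = 1} := by
    ext A
    exact mem_SO3_iff
  refine IsCompact.of_isClosed_subset hK ?_ ?_
  · rw [hset]
    refine IsClosed.inter (isClosed_eq ?_ continuous_const) (isClosed_eq ?_ continuous_const)
    · exact (Continuous.matrix_transpose continuous_id).matrix_mul continuous_id
    · exact continuous_id.matrix_det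
  · intro A hA i _ j _
    have h := congrFun (congrFun (mem_SO3_iff.1 hA).1 j) j
    simp only [Matrix.mul_apply, Matrix.transpose_apply, Matrix.one_apply_eq] at h
    have h2 : A i j * A i j ≤ 1 := by
      rw [← h]
      exact Finset.single_le_sum (f := fun t => A t j * A t j)
        (fun t _ => mul_self_nonneg _) (Finset.mem_univ i)
    exact abs_le.1 (abs_le_one_iff_mul_self_le_one.2 h2)

instance : MeasurableSpace SO3 := borel SO3

instance : BorelSpace SO3 := ⟨rfl⟩

/-- The normalized Haar measure on `SO(3)`. -/
noncomputable def haarSO3 : Measure SO3 := Measure.haarMeasure ⊤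

/-- The Frobenius norm, induced by the trace inner product `⟨A, B⟩ = trace (Aᵀ B)`. -/
noncomputable def frobeniusNorm (A : Matrix (Fin 3) (Fin 3) ℝ) : ℝ :=
  Real.sqrt (A.transpose * A).trace

/-- The kernel `2^{-p/2} ‖x - y‖_F^p` on `SO(3)`. -/
noncomputable def kernel (p : ℝ) (x y : SO3) : ℝ :=
  (2 : ℝ) ^ (-p / 2) * frobeniusNorm (x.1 - y.1) ^ p

/-- Rotation about the `z`-axis by the angle `t`. -/
noncomputable def rotZ (t : ℝ) : Matrix (Fin 3) (Fin 3) ℝ :=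
  !![Real.cos t, -Real.sin t, 0; Real.sin t, Real.cos t, 0; 0, 0, 1]

/-- Rotation about the `y`-axis by the angle `t`. -/
noncomputable def rotY (t : ℝ) : Matrix (Fin 3) (Fin 3) ℝ :=
  !![Real.cos t, 0, Real.sin t; 0, 1, 0; -Real.sin t, 0, Real.cos t]

/-- `(α, β, γ)` are Euler angles of `x` in the `z-y-z` convention. -/
def IsEulerAngles (x : SO3) (α β γ : ℝ) : Prop :=
  β ∈ Set.Icc 0 Real.pi ∧ x.1 = rotZ α * rotY β * rotZ γ

theorem rotZ_transpose_mul (t : ℝ) : (rotZ t).transpose * rotZ t = 1 := by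
  have := Real.sin_sq_add_cos_sq t
  ext i j
  fin_cases i <;> fin_cases j <;>
    simp [rotZ, Matrix.mul_apply, Fin.sum_univ_three] <;> nlinarith

theorem rotY_transpose_mul (t : ℝ) : (rotY t).transpose * rotY t = 1 := by
  have := Real.sin_sq_add_cos_sq t
  ext i j
  fin_cases i <;> fin_cases j <;>
    simp [rotY, Matrix.mul_apply, Fin.sum_univ_three] <;> nlinarith

theorem rotZ_mem (t : ℝ) : rotZ t ∈ Matrix.specialOrthogonalGroup (Fin 3) ℝ := by
  refine mem_SO3_iff.2 ⟨rotZ_transpose_mul t, ?_⟩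
  have := Real.sin_sq_add_cos_sq t
  simp [rotZ, Matrix.det_fin_three]
  nlinarith

theorem rotY_mem (t : ℝ) : rotY t ∈ Matrix.specialOrthogonalGroup (Fin 3) ℝ := by
  refine mem_SO3_iff.2 ⟨rotY_transpose_mul t, ?_⟩
  have := Real.sin_sq_add_cos_sq t
  simp [rotY, Matrix.det_fin_three]
  nlinarith

theorem exists_polar (a b : ℝ) : ∃ t : ℝ, a = Real.sqrt (a ^ 2 + b ^ 2) * Real.cos t ∧
    b = Real.sqrt (a ^ 2 + b ^ 2) * Real.sin t := by
  have hn : ‖(⟨a, b⟩ : ℂ)‖ = Real.sqrt (a ^ 2 + b ^ 2) := by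
    rw [Complex.norm_def, Complex.normSq_mk]
    ring_nf
  refine ⟨Complex.arg ⟨a, b⟩, ?_, ?_⟩
  · rw [← hn, Complex.norm_mul_cos_arg]
  · rw [← hn, Complex.norm_mul_sin_arg]

theorem eq_rotZ_of_fix (z : SO3) (h0 : z.1 0 2 = 0) (h1 : z.1 1 2 = 0) (h2 : z.1 2 2 = 1) :
    ∃ t : ℝ, z.1 = rotZ t := by
  have ho := transpose_mul_self z
  have hd := det_eq_one z
  have e : ∀ i j, ∑ t, z.1 t i * z.1 t j = (1 : Matrix (Fin 3) (Fin 3) ℝ) i j := by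
    intro i j
    rw [← ho]
    simp [Matrix.mul_apply]
  simp only [Fin.sum_univ_three] at e
  have e02 := e 0 2
  have e12 := e 1 2
  have e00 := e 0 0
  have e11 := e 1 1
  simp [h0, h1, h2] at e02 e12 e00 e11
  rw [Matrix.det_fin_three] at hd
  simp [h0, h1, h2, e02, e12] at hd e00 e11
  have hsq : (z.1 0 0 - z.1 1 1) ^ 2 + (z.1 0 1 + z.1 1 0) ^ 2 = 0 := by nlinarith
  have ha : z.1 1 1 = z.1 0 0 := by
    nlinarith [sq_nonneg (z.1 0 0 - z.1 1 1), sq_nonneg (z.1 0 1 + z.1 1 0)]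
  have hb : z.1 0 1 = -z.1 1 0 := by
    nlinarith [sq_nonneg (z.1 0 0 - z.1 1 1), sq_nonneg (z.1 0 1 + z.1 1 0)]
  obtain ⟨t, ht, ht'⟩ := exists_polar (z.1 0 0) (z.1 1 0)
  have h1' : Real.sqrt (z.1 0 0 ^ 2 + z.1 1 0 ^ 2) = 1 := by
    rw [Real.sqrt_eq_one]
    nlinarith
  rw [h1', one_mul] at ht ht'
  refine ⟨t, ?_⟩
  ext i j
  fin_cases i <;> fin_cases j <;> simp [rotZ, h0, h1, h2, e02, e12, ha, hb, ← ht, ← ht']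

/-- Every rotation has Euler angles. -/
theorem exists_eulerAngles (x : SO3) :
    ∃ e : ℝ × ℝ × ℝ, IsEulerAngles x e.1 e.2.1 e.2.2 := by
  have hc := congrFun (congrFun (transpose_mul_self x) 2) 2
  simp [Matrix.mul_apply, Fin.sum_univ_three] at hc
  have hle : x.1 2 2 ≤ 1 := by nlinarith [sq_nonneg (x.1 0 2), sq_nonneg (x.1 1 2)]
  have hge : -1 ≤ x.1 2 2 := by nlinarith [sq_nonneg (x.1 0 2), sq_nonneg (x.1 1 2)]
  obtain ⟨α, h0, h1⟩ := exists_polar (x.1 0 2) (x.1 1 2)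
  set β := Real.arccos (x.1 2 2) with hβ
  have hcos : Real.cos β = x.1 2 2 := Real.cos_arccos hge hle
  have hsin : Real.sqrt (x.1 0 2 ^ 2 + x.1 1 2 ^ 2) = Real.sin β := by
    rw [hβ, Real.sin_arccos]
    congr 1
    linarith
  rw [hsin] at h0 h1
  let z : SO3 := (⟨rotY β, rotY_mem β⟩ : SO3)⁻¹ * (⟨rotZ α, rotZ_mem α⟩ : SO3)⁻¹ * x
  have hz : z.1 = (rotY β).transpose * (rotZ α).transpose * x.1 := rfl
  have hx : x = ⟨rotZ α, rotZ_mem α⟩ * ⟨rotY β, rotY_mem β⟩ * z := by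
    simp only [z]
    group
  have t1 := Real.sin_sq_add_cos_sq α
  have t2 := Real.sin_sq_add_cos_sq β
  obtain ⟨γ, hγ⟩ := eq_rotZ_of_fix z
    (by
      rw [hz]
      simp [rotY, rotZ, Matrix.mul_apply, Fin.sum_univ_three]
      rw [h0, h1, ← hcos]
      linear_combination (Real.sin β * Real.cos β) * t1)
    (by
      rw [hz]
      simp [rotY, rotZ, Matrix.mul_apply, Fin.sum_univ_three]
      rw [h0, h1]
      ring)
    (by
      rw [hz]
      simp [rotY, rotZ, Matrix.mul_apply, Fin.sum_univ_three]
      rw [h0, h1, ← hcos]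
      linear_combination (Real.sin β ^ 2) * t1 + t2)
  refine ⟨(α, β, γ), ⟨Real.arccos_nonneg _, Real.arccos_le_pi _⟩, ?_⟩
  have := congrArg Subtype.val hx
  rw [this]
  change rotZ α * rotY β * z.1 = _
  rw [hγ]

/-- The (small) Wigner function `d^m_{k,l}(β)`, for `-m ≤ k, l ≤ m`. The sum extends over all `s`
for which the arguments of all the factorials in the denominator are nonnegative. -/
noncomputable def smallD (m : ℕ) (k l : ℤ) (β : ℝ) : ℝ :=
  Real.sqrt (((m + k).toNat.factorial : ℝ) * ((m - k).toNat.factorial : ℝ) *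
      ((m + l).toNat.factorial : ℝ) * ((m - l).toNat.factorial : ℝ)) *
    ∑ s ∈ (Finset.range (2 * m + 1)).filter
        (fun s : ℕ => 0 ≤ m + l - (s : ℤ) ∧ 0 ≤ k - l + (s : ℤ) ∧ 0 ≤ m - k - (s : ℤ)),
      (-1 : ℝ) ^ (k - l + s).toNat /
          (((m + l - s).toNat.factorial : ℝ) * (s.factorial : ℝ) *
            ((k - l + s).toNat.factorial : ℝ) * ((m - k - s).toNat.factorial : ℝ)) *
        Real.cos (β / 2) ^ (2 * m + l - k - 2 * s).toNat *
        Real.sin (β / 2) ^ (k - l + 2 * s).toNat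

/-- The Wigner function in Euler angles, `√(2m+1) e^{-ikα} d^m_{k,l}(β) e^{-ilγ}`; the factor
`√(2m+1)` makes it a unit vector in `L²` of the normalized Haar measure. -/
noncomputable def eulerD (m : ℕ) (k l : ℤ) (α β γ : ℝ) : ℂ :=
  (Real.sqrt (2 * m + 1) : ℂ) * Complex.exp (-Complex.I * k * α) * (smallD m k l β : ℂ) *
    Complex.exp (-Complex.I * l * γ)

/-- The `L²`-normalized Wigner `D`-function `D^m_{k,l}` on `SO(3)`. By `wignerD_eq` below the value
does not depend on the choice of the Euler angles. -/
noncomputable def wignerD (m : ℕ) (k l : ℤ) (x : SO3) : ℂ :=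
  eulerD m k l (exists_eulerAngles x).choose.1 (exists_eulerAngles x).choose.2.1
    (exists_eulerAngles x).choose.2.2

theorem smallD_zero {m : ℕ} {k l : ℤ} (h : k ≠ l) : smallD m k l 0 = 0 := by
  unfold smallD
  refine mul_eq_zero_of_right _ (Finset.sum_eq_zero fun s hs => ?_)
  rw [Finset.mem_filter] at hs
  refine mul_eq_zero_of_right _ ?_
  rw [zero_div, Real.sin_zero]
  exact zero_pow (by omega)

theorem smallD_pi {m : ℕ} {k l : ℤ} (h : l ≠ -k) : smallD m k l Real.pi = 0 := by
  unfold smallD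
  refine mul_eq_zero_of_right _ (Finset.sum_eq_zero fun s hs => ?_)
  rw [Finset.mem_filter] at hs
  refine mul_eq_zero_of_left (mul_eq_zero_of_right _ ?_) _
  rw [Real.cos_pi_div_two]
  exact zero_pow (by omega)

theorem exp_congr (k : ℤ) {t t' : ℝ} (hc : Real.cos t = Real.cos t')
    (hs : Real.sin t = Real.sin t') :
    Complex.exp (-Complex.I * k * t) = Complex.exp (-Complex.I * k * t') := by
  have key : ∀ r : ℝ, Complex.exp (-Complex.I * k * r) =
      ((Real.cos r : ℂ) + (Real.sin r : ℂ) * Complex.I) ^ (-k) := by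
    intro r
    rw [Complex.ofReal_cos, Complex.ofReal_sin, ← Complex.exp_mul_I, ← Complex.exp_int_mul]
    congr 1
    push_cast
    ring
  rw [key, key, hc, hs]

theorem eulerD_congr {x : SO3} {α β γ α' β' γ' : ℝ} (h : IsEulerAngles x α β γ)
    (h' : IsEulerAngles x α' β' γ') (m : ℕ) (k l : ℤ) :
    eulerD m k l α β γ = eulerD m k l α' β' γ' := by
  obtain ⟨hβ, hx⟩ := h
  obtain ⟨hβ', hx'⟩ := h'
  rw [hx] at hx'
  have e22 := congrFun (congrFun hx' 2) 2
  simp [rotY, rotZ, Matrix.mul_apply, Fin.sum_univ_three] at e22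
  have hb : β = β' := Real.injOn_cos hβ hβ' e22
  subst hb
  have e02 := congrFun (congrFun hx' 0) 2
  have e12 := congrFun (congrFun hx' 1) 2
  have e20 := congrFun (congrFun hx' 2) 0
  have e21 := congrFun (congrFun hx' 2) 1
  have e00 := congrFun (congrFun hx' 0) 0
  have e10 := congrFun (congrFun hx' 1) 0
  simp [rotY, rotZ, Matrix.mul_apply, Fin.sum_univ_three] at e02 e12 e20 e21 e00 e10
  unfold eulerD
  by_cases hs : Real.sin β = 0
  · have h0π : β = 0 ∨ β = Real.pi := by
      by_contra hcon
      push Not at hcon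
      exact (Real.sin_pos_of_pos_of_lt_pi (lt_of_le_of_ne hβ.1 (Ne.symm hcon.1))
        (lt_of_le_of_ne hβ.2 hcon.2)).ne' hs
    rcases h0π with rfl | rfl
    · by_cases hkl : k = l
      · subst hkl
        have key := exp_congr k (t := α + γ) (t' := α' + γ')
          (by simp at e00; rw [Real.cos_add, Real.cos_add]; linarith)
          (by simp at e10; rw [Real.sin_add, Real.sin_add]; linarith)
        push_cast at key
        rw [mul_add, mul_add, Complex.exp_add, Complex.exp_add] at key
        linear_combination (Real.sqrt (2 * m + 1) : ℂ) * (smallD m k k 0 : ℂ) * key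
      · simp [smallD_zero hkl]
    · by_cases hkl : l = -k
      · subst hkl
        have key := exp_congr k (t := α - γ) (t' := α' - γ')
          (by simp at e00; rw [Real.cos_sub, Real.cos_sub]; linarith)
          (by simp at e10; rw [Real.sin_sub, Real.sin_sub]; linarith)
        push_cast at key ⊢
        rw [mul_sub, mul_sub, sub_eq_add_neg, sub_eq_add_neg, Complex.exp_add,
          Complex.exp_add] at key
        have r : ∀ g : ℂ, -Complex.I * -(k : ℂ) * g = -(-Complex.I * k * g) := fun g => by ring
        rw [r, r]
        linear_combination (Real.sqrt (2 * m + 1) : ℂ) * (smallD m k (-k) Real.pi : ℂ) * key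
      · simp [smallD_pi hkl]
  · simp only [hs, or_false] at e02 e12 e20 e21
    rw [exp_congr k e02 e12, exp_congr l e20 e21]

/-- `wignerD` is given by the Euler angle formula for every choice of Euler angles. -/
theorem wignerD_eq {x : SO3} {α β γ : ℝ} (h : IsEulerAngles x α β γ) (m : ℕ) (k l : ℤ) :
    wignerD m k l x = eulerD m k l α β γ :=
  eulerD_congr (exists_eulerAngles x).choose_spec h m k l

/-- The integrand `2^{-p/2} ‖x - y‖_F^p conj(D^m_{k,l}(x)) D^m_{k,l}(y)`, where `z = (x, y)`. -/
noncomputable def coeffIntegrand (p : ℝ) (m : ℕ) (k l : ℤ) (z : SO3 × SO3) : ℂ :=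
  (kernel p z.1 z.2 : ℂ) * (starRingEnd ℂ) (wignerD m k l z.1) * wignerD m k l z.2

/-- The coefficient of the kernel `2^{-p/2} ‖x - y‖_F^p` with respect to `D^m_{k,l}`. -/
noncomputable def wignerCoeff (p : ℝ) (m : ℕ) (k l : ℤ) : ℂ :=
  ∫ z, coeffIntegrand p m k l z ∂(haarSO3.prod haarSO3)

end WignerSO3

open WignerSO3

/-!
The functions `D^m_{k,l} / √(2m + 1)` are the matrix entries of an irreducible unitary
representation: unit quaternions, embedded in the two-by-two complex matrices, act on binary forms
of degree `2m`, and this action descends along the double cover of `SO(3)`. Since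
`2^{-p/2} ‖x - y‖_F^p = 2^p |sin (ω / 2)|^p`, where `ω` is the angle of the rotation `x⁻¹ y`, is a
central function of `x⁻¹ y`, Schur's lemma shows that its coefficients depend on `m` only, and that
they are integrals of `2^p |sin (ω / 2)|^p` against the character `χ_m`, divided by `2m + 1`.

The characters are polynomials in `t = sin² (ω / 2)` with a three-term recurrence. Their
orthogonality determines the distribution of `t` for a random rotation, namely the beta
distribution with parameters `3/2` and `1/2`; its fractional moments are quotients of Gamma
functions, and the recurrence carries them over to all characters. For `p = 2n` the Pochhammer
factor vanishes when `m > n`, and the same recurrence, summed over `m`, expands `t^n` into the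
characters. The asymptotics come from Euler's limit formula for the Gamma function.
-/

namespace WignerSO3

/-! ### Symmetric powers of two-by-two matrices -/

section SymPow

open Polynomial

variable {R : Type*} [CommSemiring R]

theorem coeff_C_mul_X_add_C_pow (a b : R) (n k : ℕ) :
    ((C a * X + C b) ^ n).coeff k = a ^ k * b ^ (n - k) * n.choose k := by
  have expand : (C a * X + C b) ^ n =
      ∑ t ∈ Finset.range (n + 1), C (a ^ t * b ^ (n - t) * n.choose t) * X ^ t := by
    rw [add_pow]
    refine Finset.sum_congr rfl fun t _ => ?_
    simp only [mul_pow, map_mul, map_pow, map_natCast]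
    ring
  simp only [expand, finsetSum_coeff, coeff_C_mul_X_pow, Finset.sum_ite_eq, Finset.mem_range]
  split_ifs with hk
  · rfl
  · simp [Nat.choose_eq_zero_of_lt (not_lt.1 hk)]

theorem coeff_coeff_swap (p : R[X][X]) (i j : ℕ) :
    ((Bivariate.swap p).coeff i).coeff j = (p.coeff j).coeff i := by
  induction p using Polynomial.induction_on' with
  | add p q hp hq => simp only [map_add, coeff_add, hp, hq]
  | monomial t q =>
    induction q using Polynomial.induction_on' with
    | add q r hq hr => simp only [map_add, coeff_add, hq, hr]
    | monomial s c =>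
      rw [Bivariate.swap_monomial_monomial]
      simp only [coeff_monomial]
      split_ifs <;> simp [coeff_monomial, *]

/-- The image `(g₀₀ u + g₁₀ v) ^ j (g₀₁ u + g₁₁ v) ^ (n - j)` of the monomial `u ^ j v ^ (n - j)`
under the substitution `g`, dehomogenized at `u = X`, `v = 1`. -/
noncomputable def symColumn (n j : ℕ) (g : Matrix (Fin 2) (Fin 2) R) : R[X] :=
  (C (g 0 0) * X + C (g 1 0)) ^ j * (C (g 0 1) * X + C (g 1 1)) ^ (n - j)

theorem homogenize_symColumn {n j : ℕ} (hj : j ≤ n) (g : Matrix (Fin 2) (Fin 2) R) :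
    (symColumn n j g).homogenize n =
      (MvPolynomial.C (g 0 0) * MvPolynomial.X 0 + MvPolynomial.C (g 1 0) * MvPolynomial.X 1) ^ j *
      (MvPolynomial.C (g 0 1) * MvPolynomial.X 0 + MvPolynomial.C (g 1 1) * MvPolynomial.X 1) ^
        (n - j) := by
  have linear (a b : R) : (MvPolynomial.C a * MvPolynomial.X 0 +
      MvPolynomial.C b * MvPolynomial.X 1 : MvPolynomial (Fin 2) R).IsHomogeneous 1 :=
    (MvPolynomial.isHomogeneous_C_mul_X a 0).add (MvPolynomial.isHomogeneous_C_mul_X b 1)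
  refine homogenize_eq_of_isHomogeneous ?_ ?_
  · simpa [Nat.add_sub_cancel' hj] using ((linear _ _).pow j).mul ((linear _ _).pow (n - j))
  · simp [symColumn, MvPolynomial.algHom_C]

theorem symColumn_mul {n j : ℕ} (hj : j ≤ n) (g h : Matrix (Fin 2) (Fin 2) R) :
    symColumn n j (g * h) =
      ∑ r ∈ Finset.range (n + 1), C ((symColumn n j h).coeff r) * symColumn n r g := by
  let substitution : Fin 2 → R[X] := ![C (g 0 0) * X + C (g 1 0), C (g 0 1) * X + C (g 1 1)]
  calc symColumn n j (g * h)
      = MvPolynomial.aeval substitution ((symColumn n j h).homogenize n) := by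
        rw [homogenize_symColumn hj]
        simp only [symColumn, substitution, Matrix.mul_apply, Fin.sum_univ_two, map_add, map_mul,
          map_pow, MvPolynomial.aeval_X, MvPolynomial.algHom_C, Polynomial.algebraMap_eq,
          Matrix.cons_val_zero, Matrix.cons_val_one]
        ring
    _ = _ := by
        rw [homogenize, map_sum, Finset.Nat.sum_antidiagonal_eq_sum_range_succ_mk]
        refine Finset.sum_congr rfl fun r _ => ?_
        rw [MvPolynomial.aeval_monomial, Finsupp.update_eq_add_single (by simp),
          Finsupp.prod_add_index' (by simp) (fun _ _ _ => pow_add _ _ _)]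
        simp [symColumn, substitution]

theorem symColumn_diagonal (n j : ℕ) (a d : R) :
    symColumn n j !![a, 0; 0, d] = C (a ^ j * d ^ (n - j)) * X ^ j := by
  simp only [symColumn, Matrix.of_apply, Matrix.cons_val', Matrix.cons_val_zero,
    Matrix.cons_val_one, Matrix.cons_val_fin_one, map_zero, add_zero, zero_mul, zero_add, mul_pow,
    map_mul, map_pow]
  ring

theorem symColumn_smul {n j : ℕ} (hj : j ≤ n) (c : R) (g : Matrix (Fin 2) (Fin 2) R) :
    symColumn n j (c • g) = C (c ^ n) * symColumn n j g := by
  simp only [symColumn, Matrix.smul_apply, smul_eq_mul, map_mul, mul_assoc, ← mul_add, mul_pow]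
  rw [← map_pow, ← map_pow, mul_left_comm (_ ^ j), ← mul_assoc, ← map_mul, ← pow_add,
    Nat.add_sub_cancel' hj]

/-- The `n`-th symmetric power of a `2 × 2` matrix, in the basis of monomials
`u ^ i v ^ (n - i)`. -/
noncomputable def symPow (n : ℕ) :
    Matrix (Fin 2) (Fin 2) R →* Matrix (Fin (n + 1)) (Fin (n + 1)) R where
  toFun g := Matrix.of fun i j => (symColumn n j g).coeff i
  map_one' := by
    ext i j
    rw [Matrix.one_fin_two, Matrix.of_apply, symColumn_diagonal, coeff_C_mul_X_pow,
      Matrix.one_apply]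
    simp [Fin.ext_iff]
  map_mul' g h := by
    ext i j
    simp only [Matrix.of_apply, Matrix.mul_apply, symColumn_mul (Fin.is_le j), finsetSum_coeff,
      coeff_C_mul, Finset.sum_range]
    exact Finset.sum_congr rfl fun r _ => mul_comm _ _

theorem symPow_apply (n : ℕ) (g : Matrix (Fin 2) (Fin 2) R) (i j : Fin (n + 1)) :
    symPow n g i j = (symColumn n j g).coeff i := rfl

theorem symPow_apply_eq_sum (n : ℕ) (g : Matrix (Fin 2) (Fin 2) R) (i j : Fin (n + 1)) :
    symPow n g i j = ∑ x ∈ Finset.HasAntidiagonal.antidiagonal (i : ℕ),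
      (g 0 0 ^ x.1 * g 1 0 ^ (j - x.1) * (j : ℕ).choose x.1) *
        (g 0 1 ^ x.2 * g 1 1 ^ (n - j - x.2) * (n - j).choose x.2) := by
  simp only [symPow_apply, symColumn, coeff_mul, coeff_C_mul_X_add_C_pow]

/-- The generating function `∑ⱼ (n choose j) Y ^ j (symColumn n j g)` is the `n`-th power of the
bilinear form of `g`, which transposition of `g` turns into itself with `X` and `Y` swapped. -/
theorem choose_mul_symPow_transpose (n : ℕ) (g : Matrix (Fin 2) (Fin 2) R) (i j : Fin (n + 1)) :
    n.choose i * symPow n g.transpose j i = n.choose j * symPow n g i j := by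
  let generating (g : Matrix (Fin 2) (Fin 2) R) : R[X][X] :=
    (C (C (g 0 0) * X + C (g 1 0)) * X + C (C (g 0 1) * X + C (g 1 1))) ^ n
  have swap_generating : Bivariate.swap (generating g) = generating g.transpose := by
    simp only [generating, map_pow, map_add, map_mul, Bivariate.swap_C_C, Bivariate.swap_X,
      Bivariate.swap_Y, Matrix.transpose_apply]
    ring
  have coeff_generating (g : Matrix (Fin 2) (Fin 2) R) (i j : Fin (n + 1)) :
      ((generating g).coeff j).coeff i = n.choose j * symPow n g i j := by
    rw [coeff_C_mul_X_add_C_pow, coeff_mul_natCast, mul_comm]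
    rfl
  rw [← coeff_generating, ← coeff_generating, ← swap_generating, coeff_coeff_swap]

theorem symPow_map {S : Type*} [CommSemiring S] (f : R →+* S) (n : ℕ)
    (g : Matrix (Fin 2) (Fin 2) R) : symPow n (g.map f) = (symPow n g).map f := by
  ext i j
  simp [symPow_apply_eq_sum]

theorem symPow_smul (n : ℕ) (c : R) (g : Matrix (Fin 2) (Fin 2) R) :
    symPow n (c • g) = c ^ n • symPow n g := by
  ext i j
  rw [symPow_apply, symColumn_smul (Fin.is_le j), coeff_C_mul, Matrix.smul_apply, symPow_apply,
    smul_eq_mul]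

theorem symPow_diagonal (n : ℕ) (a d : R) :
    symPow n !![a, 0; 0, d] = Matrix.diagonal fun i : Fin (n + 1) => a ^ (i : ℕ) * d ^ (n - i) := by
  ext i j
  rw [symPow_apply, symColumn_diagonal, coeff_C_mul_X_pow, Matrix.diagonal_apply]
  simp only [Fin.ext_iff]
  split_ifs with hij
  · rw [hij]
  · rfl

theorem symPow_last (n : ℕ) (g : Matrix (Fin 2) (Fin 2) R) (i : Fin (n + 1)) :
    symPow n g i (Fin.last n) = g 0 0 ^ (i : ℕ) * g 1 0 ^ (n - i) * n.choose i := by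
  rw [symPow_apply, symColumn, Fin.val_last, Nat.sub_self, pow_zero, mul_one,
    coeff_C_mul_X_add_C_pow]

theorem continuous_symPow [TopologicalSpace R] [IsTopologicalSemiring R] (n : ℕ) :
    Continuous (symPow n : Matrix (Fin 2) (Fin 2) R → _) := by
  refine continuous_matrix fun i j => ?_
  simp only [symPow_apply_eq_sum]
  fun_prop

end SymPow

section SymRep

/-- The inverse of the norm of the monomial `u ^ i v ^ (n - i)` in the inner product that is
invariant under the unitary group and gives `u ^ n` norm one. -/
noncomputable def symWeight (n : ℕ) (i : Fin (n + 1)) : ℂ := (√(n.choose i : ℝ) : ℝ)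

theorem symWeight_ne_zero (n : ℕ) (i : Fin (n + 1)) : symWeight n i ≠ 0 := by
  have := Nat.choose_pos (Fin.is_le i)
  exact Complex.ofReal_ne_zero.2 (by positivity)

theorem symWeight_mul_self (n : ℕ) (i : Fin (n + 1)) :
    symWeight n i * symWeight n i = n.choose i := by
  rw [symWeight, ← Complex.ofReal_mul, Real.mul_self_sqrt (by positivity), Complex.ofReal_natCast]

/-- The `n`-th symmetric power of a complex `2 × 2` matrix in the orthonormal basis
`√(n choose i) u ^ i v ^ (n - i)`. -/
noncomputable def symRep (n : ℕ) :
    Matrix (Fin 2) (Fin 2) ℂ →* Matrix (Fin (n + 1)) (Fin (n + 1)) ℂ where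
  toFun g := Matrix.diagonal (symWeight n)⁻¹ * symPow n g * Matrix.diagonal (symWeight n)
  map_one' := by simp [symWeight_ne_zero]
  map_mul' g h := by
    have cancel : Matrix.diagonal (symWeight n) * Matrix.diagonal (symWeight n)⁻¹ = 1 := by
      simp [symWeight_ne_zero]
    simp only [map_mul, Matrix.mul_assoc, ← Matrix.mul_assoc (Matrix.diagonal (symWeight n)),
      cancel, Matrix.one_mul]

theorem symRep_apply (n : ℕ) (g : Matrix (Fin 2) (Fin 2) ℂ) (i j : Fin (n + 1)) :
    symRep n g i j = (symWeight n i)⁻¹ * symPow n g i j * symWeight n j := by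
  simp [symRep]

theorem symRep_conjTranspose (n : ℕ) (g : Matrix (Fin 2) (Fin 2) ℂ) :
    symRep n g.conjTranspose = (symRep n g).conjTranspose := by
  ext i j
  have transpose_symm := choose_mul_symPow_transpose n (g.map (starRingEnd ℂ)) j i
  have star_symWeight (i : Fin (n + 1)) : star (symWeight n i) = symWeight n i :=
    Complex.conj_ofReal _
  rw [← symWeight_mul_self, ← symWeight_mul_self, symPow_map (starRingEnd ℂ) n g,
    Matrix.map_apply, starRingEnd_apply] at transpose_symm
  change symRep n (g.map (starRingEnd ℂ)).transpose i j = _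
  simp only [Matrix.conjTranspose_apply, symRep_apply, star_mul', star_inv₀, star_symWeight]
  have ne_zero_i := symWeight_ne_zero n i
  have ne_zero_j := symWeight_ne_zero n j
  field_simp
  linear_combination transpose_symm

theorem symRep_neg (m : ℕ) (g : Matrix (Fin 2) (Fin 2) ℂ) :
    symRep (2 * m) (-g) = symRep (2 * m) g := by
  ext i j
  rw [symRep_apply, symRep_apply, ← neg_one_smul ℂ g, symPow_smul, pow_mul, neg_one_sq, one_pow,
    one_smul]

theorem symRep_diagonal (n : ℕ) (a d : ℂ) :
    symRep n !![a, 0; 0, d] = Matrix.diagonal fun i : Fin (n + 1) => a ^ (i : ℕ) * d ^ (n - i) := by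
  ext i j
  rw [symRep_apply, symPow_diagonal, Matrix.diagonal_apply]
  split_ifs with hij
  · rw [hij, mul_right_comm, inv_mul_cancel₀ (symWeight_ne_zero n j), one_mul]
  · simp

theorem symRep_last_ne_zero (n : ℕ) {g : Matrix (Fin 2) (Fin 2) ℂ} (h0 : g 0 0 ≠ 0)
    (h1 : g 1 0 ≠ 0) (i : Fin (n + 1)) : symRep n g i (Fin.last n) ≠ 0 := by
  have choose_ne_zero : (n.choose i : ℂ) ≠ 0 :=
    Nat.cast_ne_zero.2 (Nat.choose_pos (Fin.is_le i)).ne'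
  simp [symRep_apply, symPow_last, symWeight_ne_zero, h0, h1, choose_ne_zero]

theorem continuous_symRep (n : ℕ) : Continuous (symRep n) :=
  (continuous_const.matrix_mul (continuous_symPow n)).matrix_mul continuous_const

theorem symPow_apply_eq_sum_div_factorial (n : ℕ) (g : Matrix (Fin 2) (Fin 2) ℂ)
    (i j : Fin (n + 1)) :
    symPow n g i j = ((j : ℕ).factorial * (n - j).factorial : ℂ) *
      ∑ s ∈ Finset.range (n + 1) with s ≤ (j : ℕ) ∧ (j : ℕ) ≤ i + s ∧ i + s ≤ n,
        g 0 0 ^ (j - s) * g 0 1 ^ (i + s - j) * g 1 0 ^ s * g 1 1 ^ (n - i - s) /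
          ((j - s).factorial * s.factorial * (i + s - j).factorial * (n - i - s).factorial) := by
  rw [symPow_apply_eq_sum, Finset.mul_sum]
  symm
  refine Finset.sum_of_injOn (fun s => ((j : ℕ) - s, (i : ℕ) + s - j)) ?_ ?_ ?_ ?_
  · intro s hs t ht hst
    simp only [Finset.mem_coe, Finset.mem_filter, Prod.mk.injEq] at hs ht hst
    omega
  · intro s hs
    simp only [Finset.mem_coe, Finset.mem_filter,
      Finset.HasAntidiagonal.mem_antidiagonal] at hs ⊢
    omega
  · rintro ⟨k, l⟩ hkl hnot
    rw [Finset.HasAntidiagonal.mem_antidiagonal] at hkl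
    dsimp only at hkl ⊢
    rcases lt_or_ge (j : ℕ) k with hjk | hkj
    · simp [Nat.choose_eq_zero_of_lt hjk]
    rcases lt_or_ge (n - j : ℕ) l with hjl | hlj
    · simp [Nat.choose_eq_zero_of_lt hjl]
    refine absurd ⟨j - k, ?_, ?_⟩ hnot
    · simp only [Finset.mem_coe, Finset.mem_filter, Finset.mem_range]
      omega
    · simp only [Prod.mk.injEq]
      omega
  · intro s hs
    simp only [Finset.mem_filter, Finset.mem_range] at hs
    obtain ⟨-, hsj, hjs, hsn⟩ := hs
    rw [Nat.cast_choose ℂ (Nat.sub_le _ _), Nat.cast_choose ℂ (by omega),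
      Nat.sub_sub_self hsj, show n - j - (i + s - j) = n - i - s by omega]
    simp only [div_eq_mul_inv, mul_inv]
    ring

theorem symRep_apply_eq_sum_div_factorial (n : ℕ) (g : Matrix (Fin 2) (Fin 2) ℂ)
    (i j : Fin (n + 1)) :
    symRep n g i j = (√((i : ℕ).factorial * (n - i).factorial * (j : ℕ).factorial *
        (n - j).factorial : ℝ) : ℝ) *
      ∑ s ∈ Finset.range (n + 1) with s ≤ (j : ℕ) ∧ (j : ℕ) ≤ i + s ∧ i + s ≤ n,
        g 0 0 ^ (j - s) * g 0 1 ^ (i + s - j) * g 1 0 ^ s * g 1 1 ^ (n - i - s) /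
          ((j - s).factorial * s.factorial * (i + s - j).factorial * (n - i - s).factorial) := by
  have weight (i : Fin (n + 1)) : symWeight n i =
      (√(n.factorial : ℝ) / √((i : ℕ).factorial * (n - i).factorial : ℝ) : ℝ) := by
    rw [symWeight, Nat.cast_choose ℝ (Fin.is_le i), Real.sqrt_div (by positivity)]
  have factorials_j : ((j : ℕ).factorial * (n - j).factorial : ℂ) =
      (√((j : ℕ).factorial * (n - j).factorial : ℝ) ^ 2 : ℝ) := by
    rw [Real.sq_sqrt (by positivity)]
    norm_cast
  rw [symRep_apply, symPow_apply_eq_sum_div_factorial, mul_right_comm, ← mul_assoc]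
  congr 1
  rw [weight, weight, mul_assoc ((i : ℕ).factorial * _ : ℝ),
    Real.sqrt_mul (x := ((i : ℕ).factorial * (n - i).factorial : ℝ)) (by positivity),
    factorials_j, ← Complex.ofReal_inv, ← Complex.ofReal_mul, ← Complex.ofReal_mul,
    Complex.ofReal_inj]
  field_simp

end SymRep

/-! ### The double cover by unit quaternions -/

open scoped Quaternion

/-- The embedding of the quaternions into the complex `2 × 2` matrices under which the rotations
about the `z`-axis come from diagonal matrices. -/
noncomputable def quatMatrix : ℍ[ℝ] →* Matrix (Fin 2) (Fin 2) ℂ where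
  toFun q := !![⟨q.re, -q.imK⟩, ⟨-q.imJ, -q.imI⟩; ⟨q.imJ, -q.imI⟩, ⟨q.re, q.imK⟩]
  map_one' := by
    ext i j
    fin_cases i <;> fin_cases j <;> simp [Complex.ext_iff]
  map_mul' q r := by
    ext i j
    fin_cases i <;> fin_cases j <;>
      simp [Matrix.mul_apply, Fin.sum_univ_two, Complex.ext_iff] <;>
      constructor <;> ring

theorem quatMatrix_apply (q : ℍ[ℝ]) :
    quatMatrix q = !![⟨q.re, -q.imK⟩, ⟨-q.imJ, -q.imI⟩; ⟨q.imJ, -q.imI⟩, ⟨q.re, q.imK⟩] :=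
  rfl

theorem quatMatrix_star (q : ℍ[ℝ]) : quatMatrix (star q) = (quatMatrix q).conjTranspose := by
  ext i j
  fin_cases i <;> fin_cases j <;> simp [quatMatrix_apply, Complex.ext_iff]

theorem quatMatrix_neg (q : ℍ[ℝ]) : quatMatrix (-q) = -quatMatrix q := by
  ext i j
  fin_cases i <;> fin_cases j <;> simp [quatMatrix_apply, Complex.ext_iff]

theorem continuous_quatMatrix : Continuous quatMatrix := by
  have hmk {f g : ℍ[ℝ] → ℝ} (hf : Continuous f) (hg : Continuous g) :
      Continuous fun q => (⟨f q, g q⟩ : ℂ) :=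
    Complex.equivRealProdCLM.symm.continuous.comp (hf.prodMk hg)
  have hre := Quaternion.continuous_re
  have hI := Quaternion.continuous_imI
  have hJ := Quaternion.continuous_imJ
  have hK := Quaternion.continuous_imK
  refine continuous_matrix fun i j => ?_
  fin_cases i <;> fin_cases j
  exacts [hmk hre hK.neg, hmk hJ.neg hI.neg, hmk hJ hI.neg, hmk hre hK]

/-- The matrix of `v ↦ q v q*` on the imaginary quaternions. -/
noncomputable def quatRot : ℍ[ℝ] →* Matrix (Fin 3) (Fin 3) ℝ where
  toFun q :=
    !![q.re ^ 2 + q.imI ^ 2 - q.imJ ^ 2 - q.imK ^ 2, 2 * (q.imI * q.imJ - q.re * q.imK),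
        2 * (q.imI * q.imK + q.re * q.imJ);
      2 * (q.imI * q.imJ + q.re * q.imK), q.re ^ 2 - q.imI ^ 2 + q.imJ ^ 2 - q.imK ^ 2,
        2 * (q.imJ * q.imK - q.re * q.imI);
      2 * (q.imI * q.imK - q.re * q.imJ), 2 * (q.imJ * q.imK + q.re * q.imI),
        q.re ^ 2 - q.imI ^ 2 - q.imJ ^ 2 + q.imK ^ 2]
  map_one' := by
    ext i j
    fin_cases i <;> fin_cases j <;> simp
  map_mul' q r := by
    ext i j
    fin_cases i <;> fin_cases j <;> simp [Matrix.mul_apply, Fin.sum_univ_three] <;> ring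

theorem quatRot_apply (q : ℍ[ℝ]) :
    quatRot q =
      !![q.re ^ 2 + q.imI ^ 2 - q.imJ ^ 2 - q.imK ^ 2, 2 * (q.imI * q.imJ - q.re * q.imK),
          2 * (q.imI * q.imK + q.re * q.imJ);
        2 * (q.imI * q.imJ + q.re * q.imK), q.re ^ 2 - q.imI ^ 2 + q.imJ ^ 2 - q.imK ^ 2,
          2 * (q.imJ * q.imK - q.re * q.imI);
        2 * (q.imI * q.imK - q.re * q.imJ), 2 * (q.imJ * q.imK + q.re * q.imI),
          q.re ^ 2 - q.imI ^ 2 - q.imJ ^ 2 + q.imK ^ 2] :=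
  rfl

theorem quatRot_star (q : ℍ[ℝ]) : quatRot (star q) = (quatRot q).transpose := by
  ext i j
  fin_cases i <;> fin_cases j <;> simp [quatRot_apply] <;> ring

theorem det_quatRot (q : ℍ[ℝ]) : (quatRot q).det = Quaternion.normSq q ^ 3 := by
  rw [Quaternion.normSq_def', Matrix.det_fin_three]
  simp only [quatRot_apply, Matrix.of_apply, Matrix.cons_val]
  ring

theorem continuous_quatRot : Continuous quatRot := by
  have hre := Quaternion.continuous_re
  have hI := Quaternion.continuous_imI
  have hJ := Quaternion.continuous_imJ
  have hK := Quaternion.continuous_imK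
  refine continuous_matrix fun i j => ?_
  simp only [quatRot_apply]
  fin_cases i <;> fin_cases j <;>
    simp only [Fin.zero_eta, Fin.mk_one, Fin.reduceFinMk, Matrix.of_apply, Matrix.cons_val] <;>
    fun_prop

theorem mem_unitary_iff_normSq_eq_one {q : ℍ[ℝ]} :
    q ∈ unitary ℍ[ℝ] ↔ Quaternion.normSq q = 1 := by
  rw [Unitary.mem_iff, Quaternion.star_mul_self, Quaternion.self_mul_star, and_self,
    ← Quaternion.coe_one, Quaternion.coe_inj]

instance : CompactSpace (unitary ℍ[ℝ]) := by
  have : ProperSpace ℍ[ℝ] := FiniteDimensional.proper ℝ _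
  have h : (unitary ℍ[ℝ] : Set ℍ[ℝ]) = Metric.sphere 0 1 := by
    ext q
    rw [SetLike.mem_coe, mem_unitary_iff_normSq_eq_one, mem_sphere_zero_iff_norm,
      Quaternion.normSq_eq_norm_mul_self, ← sq,
      pow_eq_one_iff_of_nonneg (norm_nonneg q) two_ne_zero]
  exact isCompact_iff_compactSpace.1 (h ▸ isCompact_sphere 0 1)

/-- The double cover `SU(2) → SO(3)`, with `SU(2)` realized as the unit quaternions. -/
noncomputable def spinCover : unitary ℍ[ℝ] →* SO3 :=
  (quatRot.comp (unitary ℍ[ℝ]).subtype).codRestrict _ fun q => mem_SO3_iff.2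
    ⟨by
      rw [MonoidHom.comp_apply, Submonoid.subtype_apply, ← quatRot_star, ← map_mul,
        Unitary.coe_star_mul_self, map_one],
    by
      rw [MonoidHom.comp_apply, Submonoid.subtype_apply, det_quatRot,
        mem_unitary_iff_normSq_eq_one.1 q.2, one_pow]⟩

theorem coe_spinCover (q : unitary ℍ[ℝ]) : (spinCover q).1 = quatRot q := rfl

theorem continuous_spinCover : Continuous spinCover :=
  (continuous_quatRot.comp continuous_subtype_val).subtype_mk _

theorem eq_one_or_eq_neg_one_of_spinCover_eq_one {q : unitary ℍ[ℝ]} (h : spinCover q = 1) :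
    q = 1 ∨ q = -1 := by
  have hq : q.1.re ^ 2 + q.1.imI ^ 2 + q.1.imJ ^ 2 + q.1.imK ^ 2 = 1 :=
    (Quaternion.normSq_def' _).symm.trans (mem_unitary_iff_normSq_eq_one.1 q.2)
  have h00 : q.1.re ^ 2 + q.1.imI ^ 2 - q.1.imJ ^ 2 - q.1.imK ^ 2 = 1 :=
    congrFun (congrFun (congrArg Subtype.val h) 0) 0
  have h11 : q.1.re ^ 2 - q.1.imI ^ 2 + q.1.imJ ^ 2 - q.1.imK ^ 2 = 1 :=
    congrFun (congrFun (congrArg Subtype.val h) 1) 1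
  have hI : q.1.imI = 0 := by nlinarith [sq_nonneg q.1.imI, sq_nonneg q.1.imJ, sq_nonneg q.1.imK]
  have hJ : q.1.imJ = 0 := by nlinarith [sq_nonneg q.1.imI, sq_nonneg q.1.imJ, sq_nonneg q.1.imK]
  have hK : q.1.imK = 0 := by nlinarith [sq_nonneg q.1.imI, sq_nonneg q.1.imJ, sq_nonneg q.1.imK]
  have hre : q.1.re ^ 2 = 1 := by simpa [hI, hJ, hK] using hq
  refine (sq_eq_one_iff.1 hre).imp (fun h => ?_) fun h => ?_ 
  · ext <;> simp [hI, hJ, hK, h]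
  · ext <;> simp [Unitary.coe_neg, hI, hJ, hK, h]

theorem eq_or_eq_neg_of_spinCover_eq {q r : unitary ℍ[ℝ]} (h : spinCover q = spinCover r) :
    q = r ∨ q = -r := by
  have hqr : spinCover (q * r⁻¹) = 1 := by rw [map_mul, map_inv, h, mul_inv_cancel]
  refine (eq_one_or_eq_neg_one_of_spinCover_eq_one hqr).imp mul_inv_eq_one.1 fun hneg => ?_
  rw [eq_mul_of_mul_inv_eq hneg, neg_one_mul]

theorem cos_eq_cos_half_sq_sub_sin_half_sq (t : ℝ) :
    Real.cos t = Real.cos (t / 2) ^ 2 - Real.sin (t / 2) ^ 2 := by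
  rw [← Real.cos_two_mul', mul_div_cancel₀ t two_ne_zero]

theorem sin_eq_two_mul_sin_half_mul_cos_half (t : ℝ) :
    Real.sin t = 2 * Real.sin (t / 2) * Real.cos (t / 2) := by
  rw [← Real.sin_two_mul, mul_div_cancel₀ t two_ne_zero]

/-- The rotation about the `z`-axis by the angle `t`, as an element of `SO(3)`. -/
noncomputable def zRot (t : ℝ) : SO3 := ⟨rotZ t, rotZ_mem t⟩

/-- The rotation about the `y`-axis by the angle `t`, as an element of `SO(3)`. -/
noncomputable def yRot (t : ℝ) : SO3 := ⟨rotY t, rotY_mem t⟩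

/-- A unit quaternion over `zRot t`. -/
noncomputable def quatZ (t : ℝ) : unitary ℍ[ℝ] :=
  ⟨⟨Real.cos (t / 2), 0, 0, Real.sin (t / 2)⟩,
    mem_unitary_iff_normSq_eq_one.2 ((Quaternion.normSq_def' _).trans (by simp))⟩

/-- A unit quaternion over `yRot t`. -/
noncomputable def quatY (t : ℝ) : unitary ℍ[ℝ] :=
  ⟨⟨Real.cos (t / 2), 0, Real.sin (t / 2), 0⟩,
    mem_unitary_iff_normSq_eq_one.2 ((Quaternion.normSq_def' _).trans (by simp))⟩

theorem spinCover_quatZ (t : ℝ) : spinCover (quatZ t) = zRot t := by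
  have hcos := cos_eq_cos_half_sq_sub_sin_half_sq t
  have hsin := sin_eq_two_mul_sin_half_mul_cos_half t
  ext i j
  rw [coe_spinCover, quatRot_apply]
  fin_cases i <;> fin_cases j <;> simp [quatZ, zRot, rotZ] <;>
    linarith [Real.cos_sq_add_sin_sq (t / 2)]

theorem spinCover_quatY (t : ℝ) : spinCover (quatY t) = yRot t := by
  have hcos := cos_eq_cos_half_sq_sub_sin_half_sq t
  have hsin := sin_eq_two_mul_sin_half_mul_cos_half t
  ext i j
  rw [coe_spinCover, quatRot_apply]
  fin_cases i <;> fin_cases j <;> simp [quatY, yRot, rotY] <;>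
    linarith [Real.cos_sq_add_sin_sq (t / 2)]

theorem IsEulerAngles.eq_zRot_mul_yRot_mul_zRot {x : SO3} {α β γ : ℝ}
    (h : IsEulerAngles x α β γ) : x = zRot α * yRot β * zRot γ :=
  Subtype.ext h.2

theorem surjective_spinCover : Function.Surjective spinCover := fun x => by
  obtain ⟨⟨α, β, γ⟩, h⟩ := exists_eulerAngles x
  refine ⟨quatZ α * quatY β * quatZ γ, ?_⟩
  rw [map_mul, map_mul, spinCover_quatZ, spinCover_quatZ, spinCover_quatY,
    h.eq_zRot_mul_yRot_mul_zRot]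

theorem isQuotientMap_spinCover : IsQuotientMap spinCover :=
  continuous_spinCover.isClosedMap.isQuotientMap continuous_spinCover surjective_spinCover

/-! ### Wigner matrices -/

theorem quatMatrix_quatY (t : ℝ) : quatMatrix (quatY t) =
    !![(Real.cos (t / 2) : ℂ), -(Real.sin (t / 2) : ℂ);
      (Real.sin (t / 2) : ℂ), (Real.cos (t / 2) : ℂ)] := by
  ext i j
  rw [quatMatrix_apply, ← Complex.ofReal_neg]
  fin_cases i <;> fin_cases j <;> simp [quatY, -Complex.ofReal_cos, -Complex.ofReal_sin,
    Complex.ext_iff]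

theorem quatMatrix_quatZ (t : ℝ) : quatMatrix (quatZ t) =
    !![Complex.exp (-(t / 2 * Complex.I)), 0; 0, Complex.exp (t / 2 * Complex.I)] := by
  have hexp (s : ℝ) : Complex.exp (s * Complex.I) = ⟨Real.cos s, Real.sin s⟩ :=
    Complex.ext (Complex.exp_ofReal_mul_I_re s) (Complex.exp_ofReal_mul_I_im s)
  have hpos := hexp (t / 2)
  have hneg := hexp (-(t / 2))
  push_cast at hpos hneg
  rw [← neg_mul, hpos, hneg]
  ext i j
  rw [quatMatrix_apply]
  fin_cases i <;> fin_cases j <;> simp [quatZ, Complex.ext_iff]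

theorem symRep_quatMatrix_quatZ (m : ℕ) (t : ℝ) :
    symRep (2 * m) (quatMatrix (quatZ t)) =
      Matrix.diagonal fun i : Fin (2 * m + 1) =>
        Complex.exp (-Complex.I * (((i : ℤ) - m : ℤ) : ℂ) * t) := by
  rw [quatMatrix_quatZ, symRep_diagonal]
  congr 1
  ext i
  rw [← Complex.exp_nat_mul, ← Complex.exp_nat_mul, ← Complex.exp_add, Nat.cast_sub (by lia)]
  congr 1
  push_cast
  ring

theorem smallD_eq_symRep (m : ℕ) (i j : Fin (2 * m + 1)) (β : ℝ) :
    (smallD m ((i : ℤ) - m) ((j : ℤ) - m) β : ℂ) =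
      symRep (2 * m) (quatMatrix (quatY β)) i j := by
  have hi := i.2
  have hj := j.2
  rw [symRep_apply_eq_sum_div_factorial, smallD,
    show (m + ((i : ℤ) - m)).toNat = i by lia, show (m - ((i : ℤ) - m)).toNat = 2 * m - i by lia,
    show (m + ((j : ℤ) - m)).toNat = j by lia, show (m - ((j : ℤ) - m)).toNat = 2 * m - j by lia,
    Complex.ofReal_mul]
  congr 1
  rw [Complex.ofReal_sum]
  refine Finset.sum_congr (Finset.filter_congr fun s _ => by lia) fun s hs => ?_
  obtain ⟨-, hs⟩ := Finset.mem_filter.1 hs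
  rw [show (m + ((j : ℤ) - m) - s).toNat = j - s by lia,
    show ((i : ℤ) - m - ((j : ℤ) - m) + s).toNat = i + s - j by lia,
    show (m - ((i : ℤ) - m) - s).toNat = 2 * m - i - s by lia,
    show (2 * m + ((j : ℤ) - m) - ((i : ℤ) - m) - 2 * s).toNat =
      (j - s) + (2 * m - i - s) by lia,
    show ((i : ℤ) - m - ((j : ℤ) - m) + 2 * s).toNat = (i + s - j) + s by lia,
    quatMatrix_quatY]
  simp only [Matrix.of_apply, Matrix.cons_val]
  rw [pow_add, pow_add, neg_pow (Real.sin _ : ℂ)]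
  push_cast
  ring

/-- The matrix of the functions `D^m_{k,l} / √(2m+1)`, rows and columns being shifted by `m` so as
to be indexed from `0` to `2m`. -/
noncomputable def wignerMatrix (m : ℕ) (x : SO3) : Matrix (Fin (2 * m + 1)) (Fin (2 * m + 1)) ℂ :=
  Matrix.of fun i j => wignerD m ((i : ℤ) - m) ((j : ℤ) - m) x / (√(2 * m + 1) : ℝ)

theorem wignerMatrix_spinCover (m : ℕ) (q : unitary ℍ[ℝ]) :
    wignerMatrix m (spinCover q) = symRep (2 * m) (quatMatrix q) := by
  obtain ⟨⟨α, β, γ⟩, he⟩ := exists_eulerAngles (spinCover q)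
  have heuler : wignerMatrix m (spinCover q) =
      symRep (2 * m) (quatMatrix ↑(quatZ α * quatY β * quatZ γ)) := by
    have h0 : ((√(2 * m + 1) : ℝ) : ℂ) ≠ 0 := Complex.ofReal_ne_zero.2 (by positivity)
    simp only [Submonoid.coe_mul, map_mul, symRep_quatMatrix_quatZ]
    ext i j
    rw [Matrix.mul_diagonal, Matrix.diagonal_mul, ← smallD_eq_symRep, wignerMatrix,
      Matrix.of_apply, wignerD_eq he, eulerD]
    field_simp
  have hcover : spinCover q = spinCover (quatZ α * quatY β * quatZ γ) := by
    rw [map_mul, map_mul, spinCover_quatZ, spinCover_quatZ, spinCover_quatY,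
      ← he.eq_zRot_mul_yRot_mul_zRot]
  rcases eq_or_eq_neg_of_spinCover_eq hcover with h | h
  · rw [heuler, h]
  · rw [heuler, h, Unitary.coe_neg, quatMatrix_neg, symRep_neg]

/-- The unitary representation of `SO(3)` whose matrix entries are the functions
`D^m_{k,l} / √(2m+1)`. -/
noncomputable def wignerRep (m : ℕ) : SO3 →* Matrix (Fin (2 * m + 1)) (Fin (2 * m + 1)) ℂ where
  toFun := wignerMatrix m
  map_one' := by
    rw [← map_one spinCover, wignerMatrix_spinCover, OneMemClass.coe_one, map_one, map_one]
  map_mul' x y := by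
    obtain ⟨q, rfl⟩ := surjective_spinCover x
    obtain ⟨r, rfl⟩ := surjective_spinCover y
    rw [← map_mul, wignerMatrix_spinCover, wignerMatrix_spinCover, wignerMatrix_spinCover,
      Submonoid.coe_mul, map_mul, map_mul]

theorem wignerRep_spinCover (m : ℕ) (q : unitary ℍ[ℝ]) :
    wignerRep m (spinCover q) = symRep (2 * m) (quatMatrix q) :=
  wignerMatrix_spinCover m q

theorem wignerD_eq_wignerRep (m : ℕ) (x : SO3) (i j : Fin (2 * m + 1)) :
    wignerD m ((i : ℤ) - m) ((j : ℤ) - m) x = (√(2 * m + 1) : ℝ) * wignerRep m x i j :=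
  (mul_div_cancel₀ _ (Complex.ofReal_ne_zero.2 (by positivity))).symm

theorem wignerRep_inv (m : ℕ) (x : SO3) : wignerRep m x⁻¹ = (wignerRep m x).conjTranspose := by
  obtain ⟨q, rfl⟩ := surjective_spinCover x
  rw [← map_inv, wignerRep_spinCover, wignerRep_spinCover, ← symRep_conjTranspose,
    ← quatMatrix_star]
  rfl

theorem continuous_wignerRep (m : ℕ) : Continuous (wignerRep m) := by
  have hcomp : wignerRep m ∘ spinCover = fun q : unitary ℍ[ℝ] => symRep (2 * m) (quatMatrix q) :=
    funext (wignerRep_spinCover m)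
  rw [isQuotientMap_spinCover.continuous_iff, hcomp]
  exact (continuous_symRep _).comp (continuous_quatMatrix.comp continuous_subtype_val)

theorem wignerRep_zRot (m : ℕ) (t : ℝ) :
    wignerRep m (zRot t) = Matrix.diagonal fun i : Fin (2 * m + 1) =>
      Complex.exp (-Complex.I * (((i : ℤ) - m : ℤ) : ℂ) * t) := by
  rw [← spinCover_quatZ, wignerRep_spinCover, symRep_quatMatrix_quatZ]

theorem wignerRep_yRot_last_ne_zero (m : ℕ) {t : ℝ} (ht0 : 0 < t) (htπ : t < Real.pi)
    (i : Fin (2 * m + 1)) : wignerRep m (yRot t) i (Fin.last (2 * m)) ≠ 0 := by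
  have hcos : Real.cos (t / 2) ≠ 0 := (Real.cos_pos_of_mem_Ioo ⟨by linarith, by linarith⟩).ne'
  have hsin : Real.sin (t / 2) ≠ 0 := (Real.sin_pos_of_pos_of_lt_pi (by linarith) (by linarith)).ne'
  rw [← spinCover_quatY, wignerRep_spinCover, quatMatrix_quatY]
  exact symRep_last_ne_zero _ (Complex.ofReal_ne_zero.2 hcos) (Complex.ofReal_ne_zero.2 hsin) i

theorem injective_exp_neg_I_mul_int :
    Function.Injective fun k : ℤ => Complex.exp (-Complex.I * k * (1 : ℝ)) := by
  intro k l h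
  obtain ⟨n, hn⟩ := Complex.exp_eq_exp_iff_exists_int.1 h
  have hkl : ((l - k : ℤ) : ℝ) = (2 * n : ℤ) * Real.pi := by
    have him := congrArg Complex.im hn
    simp at him
    push_cast
    linarith
  by_contra hne
  have hn0 : 2 * n ≠ 0 := by
    intro h0
    rw [h0, Int.cast_zero, zero_mul, Int.cast_eq_zero] at hkl
    lia
  exact (irrational_pi.intCast_mul hn0).ne_int _ hkl.symm

theorem eq_diagonal_of_commute_diagonal {ι R : Type*} [Fintype ι] [DecidableEq ι] [CommRing R]
    [NoZeroDivisors R] {A : Matrix ι ι R} {d : ι → R} (hd : Function.Injective d)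
    (h : Commute A (Matrix.diagonal d)) : A = Matrix.diagonal fun i => A i i := by
  ext i j
  rw [Matrix.diagonal_apply]
  split_ifs with hij
  · rw [hij]
  · have hcomm := congrFun (congrFun h i) j
    rw [Matrix.mul_diagonal, Matrix.diagonal_mul, mul_comm, ← sub_eq_zero, ← sub_mul] at hcomm
    exact (mul_eq_zero.1 hcomm).resolve_left (sub_ne_zero.2 (hd.ne (Ne.symm hij)))

theorem diagonal_eq_smul_one_of_commute {ι R : Type*} [Fintype ι] [DecidableEq ι] [CommRing R]
    [NoZeroDivisors R] {B : Matrix ι ι R} {d : ι → R} {j : ι} (hB : ∀ i, B i j ≠ 0)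
    (h : Commute (Matrix.diagonal d) B) : Matrix.diagonal d = d j • (1 : Matrix ι ι R) := by
  rw [Matrix.smul_one_eq_diagonal]
  congr 1
  ext i
  have hcomm := congrFun (congrFun h i) j
  rw [Matrix.mul_diagonal, Matrix.diagonal_mul, mul_comm] at hcomm
  exact mul_left_cancel₀ (hB i) hcomm

/-- Irreducibility: rotations about the `z`-axis force an intertwiner to be diagonal, and a column
without zeros of one rotation about the `y`-axis then forces it to be scalar. -/
theorem exists_eq_smul_one_of_commute_wignerRep {m : ℕ}
    {A : Matrix (Fin (2 * m + 1)) (Fin (2 * m + 1)) ℂ} (h : ∀ x, Commute A (wignerRep m x)) :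
    ∃ c : ℂ, A = c • (1 : Matrix (Fin (2 * m + 1)) (Fin (2 * m + 1)) ℂ) := by
  have hinj : Function.Injective fun i : Fin (2 * m + 1) =>
      Complex.exp (-Complex.I * (((i : ℤ) - m : ℤ) : ℂ) * (1 : ℝ)) := fun i j hij =>
    Fin.ext (by have := injective_exp_neg_I_mul_int hij; lia)
  have hA := eq_diagonal_of_commute_diagonal hinj (wignerRep_zRot m 1 ▸ h (zRot 1))
  refine ⟨A (Fin.last _) (Fin.last _), ?_⟩
  have hcomm := h (yRot 1)
  rw [hA] at hcomm
  have hlast := wignerRep_yRot_last_ne_zero m one_pos (by linarith [Real.pi_gt_three])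
  exact hA.trans (diagonal_eq_smul_one_of_commute hlast hcomm)

/-! ### Matrix coefficients of compact groups -/

section CompactGroup

variable {G ι : Type*} [Group G] [Fintype ι] [DecidableEq ι]

theorem convolution_mul_star_apply_mul_apply (ρ : G →* Matrix ι ι ℂ) (f : G → ℂ) (k l : ι)
    (x y : G) :
    f (x⁻¹ * y) * star (ρ x k l) * ρ y k l =
      ∑ j, (star (ρ x k l) * ρ x k j) * (f (x⁻¹ * y) * ρ (x⁻¹ * y) j l) := by
  have hy : ρ y k l = ∑ j, ρ x k j * ρ (x⁻¹ * y) j l := by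
    rw [← Matrix.mul_apply, ← map_mul, mul_inv_cancel_left]
  rw [hy, Finset.mul_sum]
  exact Finset.sum_congr rfl fun j _ => by ring

variable [TopologicalSpace G]

/-- A continuous unitary matrix representation whose only intertwiners are the scalars; by Schur's
lemma the last condition expresses irreducibility. -/
structure IsIrreducibleUnitaryRep (ρ : G →* Matrix ι ι ℂ) : Prop where
  continuous : Continuous ρ
  map_inv (g : G) : ρ g⁻¹ = (ρ g).conjTranspose
  exists_eq_smul_one {A : Matrix ι ι ℂ} (hA : ∀ g, Commute A (ρ g)) : ∃ c : ℂ, A = c • 1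

/-- The Fourier coefficient `∫ f ρ dμ` of a function at a matrix representation. -/
noncomputable def fourierMatrix [MeasurableSpace G] (μ : Measure G) (ρ : G →* Matrix ι ι ℂ)
    (f : G → ℂ) : Matrix ι ι ℂ :=
  Matrix.of fun i j => ∫ x, f x * ρ x i j ∂μ

variable {ρ : G →* Matrix ι ι ℂ}

namespace IsIrreducibleUnitaryRep

theorem mul_conjTranspose_self (hρ : IsIrreducibleUnitaryRep ρ) (g : G) :
    ρ g * (ρ g).conjTranspose = 1 := by
  rw [← hρ.map_inv, ← map_mul, mul_inv_cancel, map_one]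

theorem continuous_apply (hρ : IsIrreducibleUnitaryRep ρ) (i j : ι) :
    Continuous fun x => ρ x i j :=
  hρ.continuous.matrix_elem i j

theorem eq_trace_div_card_smul_one {A : Matrix ι ι ℂ} (hρ : IsIrreducibleUnitaryRep ρ)
    (hA : ∀ g, Commute A (ρ g)) : A = (A.trace / Fintype.card ι) • (1 : Matrix ι ι ℂ) := by
  obtain ⟨c, rfl⟩ := hρ.exists_eq_smul_one hA
  rw [Matrix.trace_smul, Matrix.trace_one, smul_eq_mul]
  ext i
  have hcard : (Fintype.card ι : ℂ) ≠ 0 := Nat.cast_ne_zero.2 (Fintype.card_pos_iff.2 ⟨i⟩).ne'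
  rw [mul_div_cancel_right₀ _ hcard]

variable [CompactSpace G] [MeasurableSpace G] [BorelSpace G] {μ : Measure G} {f : G → ℂ}

theorem integrable_mul_apply (hρ : IsIrreducibleUnitaryRep ρ) (hf : Integrable f μ) (i j : ι) :
    Integrable (fun x => f x * ρ x i j) μ := by
  have hcont := hρ.continuous_apply i j
  obtain ⟨C, hC⟩ := isCompact_univ.exists_bound_of_continuousOn hcont.continuousOn
  exact hf.mul_bdd hcont.aestronglyMeasurable (ae_of_all _ fun x => hC x (Set.mem_univ x))

theorem integrable_star_apply [IsFiniteMeasure μ] (hρ : IsIrreducibleUnitaryRep ρ) (k l : ι) :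
    Integrable (fun x => star (ρ x k l)) μ :=
  (hρ.continuous_apply k l).star.integrable_of_hasCompactSupport (.of_compactSpace _)

theorem integrable_star_apply_mul_apply_mul_prod [IsFiniteMeasure μ]
    (hρ : IsIrreducibleUnitaryRep ρ) (hf : Integrable f μ) (k l j : ι) :
    Integrable (fun z : G × G => (star (ρ z.1 k l) * ρ z.1 k j) * (f z.2 * ρ z.2 j l))
      (μ.prod μ) :=
  (hρ.integrable_mul_apply (hρ.integrable_star_apply k l) k j).mul_prod
    (hρ.integrable_mul_apply hf j l)

theorem trace_fourierMatrix (hρ : IsIrreducibleUnitaryRep ρ) (hf : Integrable f μ) :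
    (fourierMatrix μ ρ f).trace = ∫ x, f x * (ρ x).trace ∂μ := by
  simp only [Matrix.trace, Matrix.diag, fourierMatrix, Matrix.of_apply, Finset.mul_sum]
  rw [integral_finsetSum _ fun k _ => hρ.integrable_mul_apply hf k k]

variable [IsTopologicalGroup G]

theorem fourierMatrix_mul [μ.IsMulRightInvariant] (hρ : IsIrreducibleUnitaryRep ρ)
    (hf : Integrable f μ) (g : G) :
    fourierMatrix μ ρ f * ρ g = fourierMatrix μ ρ fun x => f (x * g⁻¹) := by
  ext i j
  rw [Matrix.mul_apply]
  simp only [fourierMatrix, Matrix.of_apply]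
  rw [← integral_mul_right_eq_self _ g]
  simp only [mul_inv_cancel_right, map_mul, Matrix.mul_apply, Finset.mul_sum, ← mul_assoc]
  rw [integral_finsetSum _ fun k _ => (hρ.integrable_mul_apply hf i k).mul_const _]
  simp_rw [integral_mul_const]

theorem mul_fourierMatrix [μ.IsMulLeftInvariant] (hρ : IsIrreducibleUnitaryRep ρ)
    (hf : Integrable f μ) (g : G) :
    ρ g * fourierMatrix μ ρ f = fourierMatrix μ ρ fun x => f (g⁻¹ * x) := by
  ext i j
  rw [Matrix.mul_apply]
  simp only [fourierMatrix, Matrix.of_apply]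
  rw [← integral_mul_left_eq_self _ g]
  simp only [inv_mul_cancel_left, map_mul, Matrix.mul_apply, Finset.mul_sum, mul_left_comm (f _)]
  rw [integral_finsetSum _ fun k _ => (hρ.integrable_mul_apply hf k j).const_mul _]
  simp_rw [integral_const_mul]

theorem fourierMatrix_of_central [μ.IsMulLeftInvariant] [μ.IsMulRightInvariant]
    (hρ : IsIrreducibleUnitaryRep ρ) (hf : Integrable f μ)
    (hcentral : ∀ x y, f (x * y) = f (y * x)) :
    fourierMatrix μ ρ f =
      ((∫ x, f x * (ρ x).trace ∂μ) / Fintype.card ι) • (1 : Matrix ι ι ℂ) := by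
  rw [← hρ.trace_fourierMatrix hf]
  refine hρ.eq_trace_div_card_smul_one fun g => ?_
  rw [commute_iff_eq, hρ.fourierMatrix_mul hf, hρ.mul_fourierMatrix hf]
  simp_rw [hcentral _ g⁻¹]

theorem integral_trace_eq_zero [IsFiniteMeasure μ] [μ.IsMulLeftInvariant] [μ.IsMulRightInvariant]
    (hρ : IsIrreducibleUnitaryRep ρ) {g : G} (hg : ρ g ≠ 1) : ∫ x, (ρ x).trace ∂μ = 0 := by
  have hone : Integrable (fun _ : G => (1 : ℂ)) μ := integrable_const 1
  have hscalar := hρ.fourierMatrix_of_central hone fun _ _ => rfl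
  have htrace := hρ.trace_fourierMatrix hone
  have hfix := hρ.mul_fourierMatrix hone g
  simp only [one_mul] at hscalar htrace
  rw [hscalar, mul_smul_comm, mul_one] at hfix
  have hc : (∫ x, (ρ x).trace ∂μ) / Fintype.card ι = 0 :=
    not_not.1 fun hc => hg (smul_right_injective _ hc hfix)
  rw [← htrace, hscalar, hc, zero_smul, Matrix.trace_zero]

/-- The functions `x ↦ star (ρ x k l)`, with `k` fixed, are permuted linearly by right translations,
so that their Fourier coefficients assemble into an intertwiner. -/
theorem integral_star_apply_mul_apply [IsProbabilityMeasure μ] [μ.IsMulRightInvariant]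
    (hρ : IsIrreducibleUnitaryRep ρ) (k l j : ι) :
    ∫ x, star (ρ x k l) * ρ x k j ∂μ = if l = j then (Fintype.card ι : ℂ)⁻¹ else 0 := by
  set N : Matrix ι ι ℂ :=
    Matrix.of fun l j => ∫ x, star (ρ x k l) * ρ x k j ∂μ with hN
  have hcomm (g : G) : Commute N (ρ g) := by
    ext l j
    have hshift (x : G) : star (ρ (x * g⁻¹) k l) = ∑ a, ρ g l a * star (ρ x k a) := by
      simp only [map_mul, hρ.map_inv, Matrix.mul_apply, Matrix.conjTranspose_apply, star_sum,
        star_mul', star_star, mul_comm]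
    calc (N * ρ g) l j = (fourierMatrix μ ρ (fun x => star (ρ x k l)) * ρ g) k j := rfl
      _ = ∫ x, ∑ a, ρ g l a * (star (ρ x k a) * ρ x k j) ∂μ := by
        rw [hρ.fourierMatrix_mul (hρ.integrable_star_apply k l)]
        simp only [fourierMatrix, Matrix.of_apply, hshift, Finset.sum_mul, mul_assoc]
      _ = (ρ g * N) l j := by
        rw [integral_finsetSum _ fun a _ =>
          (hρ.integrable_mul_apply (hρ.integrable_star_apply k a) k j).const_mul _]
        simp only [integral_const_mul, Matrix.mul_apply, hN, Matrix.of_apply]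
  have htrace : N.trace = 1 := by
    have hrow (x : G) : ∑ a, star (ρ x k a) * ρ x k a = 1 := by
      have h := congrFun (congrFun (hρ.mul_conjTranspose_self x) k) k
      simpa only [Matrix.mul_apply, Matrix.conjTranspose_apply, mul_comm, Matrix.one_apply_eq]
        using h
    simp only [Matrix.trace, Matrix.diag, hN, Matrix.of_apply]
    rw [← integral_finsetSum _ fun a _ =>
      hρ.integrable_mul_apply (hρ.integrable_star_apply k a) k a]
    simp only [hrow, integral_const, probReal_univ, one_smul]
  have hscalar := congrFun (congrFun (hρ.eq_trace_div_card_smul_one hcomm) l) j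
  rw [htrace, Matrix.smul_apply, Matrix.one_apply, one_div] at hscalar
  simpa only [hN, Matrix.of_apply, smul_eq_mul, mul_ite, mul_one, mul_zero] using hscalar

section Convolution

variable [MeasurableMul₂ G] [IsProbabilityMeasure μ] [μ.IsMulLeftInvariant]

theorem integrable_convolution (hρ : IsIrreducibleUnitaryRep ρ) (hf : Integrable f μ) (k l : ι) :
    Integrable (fun z : G × G => f (z.1⁻¹ * z.2) * star (ρ z.1 k l) * ρ z.2 k l) (μ.prod μ) := by
  simp_rw [convolution_mul_star_apply_mul_apply]
  exact (measurePreserving_prod_inv_mul μ μ).integrable_comp_of_integrable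
    (integrable_finsetSum _ fun j _ => hρ.integrable_star_apply_mul_apply_mul_prod hf k l j)

theorem integral_convolution_of_central [μ.IsMulRightInvariant]
    (hρ : IsIrreducibleUnitaryRep ρ) (hf : Integrable f μ)
    (hcentral : ∀ x y, f (x * y) = f (y * x)) (k l : ι) :
    ∫ z : G × G, f (z.1⁻¹ * z.2) * star (ρ z.1 k l) * ρ z.2 k l ∂μ.prod μ =
      (∫ x, f x * (ρ x).trace ∂μ) / (Fintype.card ι : ℂ) ^ 2 := by
  let F (z : G × G) : ℂ := ∑ j, (star (ρ z.1 k l) * ρ z.1 k j) * (f z.2 * ρ z.2 j l)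
  have hfourier (j : ι) : ∫ x, f x * ρ x j l ∂μ =
      if j = l then (∫ x, f x * (ρ x).trace ∂μ) / Fintype.card ι else 0 := by
    have h := congrFun (congrFun (hρ.fourierMatrix_of_central hf hcentral) j) l
    simpa only [fourierMatrix, Matrix.of_apply, Matrix.smul_apply, Matrix.one_apply, smul_eq_mul,
      mul_ite, mul_one, mul_zero] using h
  calc ∫ z : G × G, f (z.1⁻¹ * z.2) * star (ρ z.1 k l) * ρ z.2 k l ∂μ.prod μ
      = ∫ z, F (z.1, z.1⁻¹ * z.2) ∂μ.prod μ := by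
        simp_rw [convolution_mul_star_apply_mul_apply, F]
    _ = ∫ z, F z ∂μ.prod μ :=
        (measurePreserving_prod_inv_mul μ μ).integral_comp
          (MeasurableEquiv.shearMulRight G).symm.measurableEmbedding F
    _ = ∑ j, (∫ x, star (ρ x k l) * ρ x k j ∂μ) * ∫ x, f x * ρ x j l ∂μ := by
        rw [integral_finsetSum _ fun j _ => hρ.integrable_star_apply_mul_apply_mul_prod hf k l j]
        exact Finset.sum_congr rfl fun j _ => integral_prod_mul
          (fun x => star (ρ x k l) * ρ x k j) fun x => f x * ρ x j l
    _ = (∫ x, f x * (ρ x).trace ∂μ) / (Fintype.card ι : ℂ) ^ 2 := by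
        simp only [hρ.integral_star_apply_mul_apply, hfourier, ite_mul, zero_mul,
          Finset.sum_ite_eq, Finset.mem_univ, if_true]
        ring

end Convolution

end IsIrreducibleUnitaryRep

end CompactGroup

/-! ### The characters of the rotation group -/

theorem exists_mulVec_eq_self_of_odd_card {n K : Type*} [Fintype n] [DecidableEq n] [Field K]
    [CharZero K] (hn : Odd (Fintype.card n)) {A : Matrix n n K} (hA : A * A.transpose = 1)
    (hdet : A.det = 1) : ∃ v, v ≠ 0 ∧ A.mulVec v = v := by
  have hfactor : A - 1 = -(A * (A - 1).transpose) := by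
    rw [Matrix.transpose_sub, mul_sub, hA, Matrix.transpose_one, mul_one, neg_sub]
  have hneg : (A - 1).det = -(A - 1).det := by
    conv_lhs => rw [hfactor, Matrix.det_neg, Matrix.det_mul, Matrix.det_transpose, hdet,
      hn.neg_one_pow, one_mul, neg_one_mul]
  obtain ⟨v, hv, h⟩ := Matrix.exists_mulVec_eq_zero_iff.2 (self_eq_neg.1 hneg)
  refine ⟨v, hv, ?_⟩
  rwa [Matrix.sub_mulVec, Matrix.one_mulVec, sub_eq_zero] at h

theorem exists_smul_zRot_mul_yRot_mulVec_eq (v : Fin 3 → ℝ) : ∃ α β r : ℝ,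
    r • (zRot α * yRot β).1.mulVec ![0, 0, 1] = v := by
  obtain ⟨α, h0, h1⟩ := exists_polar (v 0) (v 1)
  obtain ⟨β, h2, h3⟩ := exists_polar (v 2) (√(v 0 ^ 2 + v 1 ^ 2))
  refine ⟨α, β, √(v 2 ^ 2 + √(v 0 ^ 2 + v 1 ^ 2) ^ 2), ?_⟩
  set r := √(v 2 ^ 2 + √(v 0 ^ 2 + v 1 ^ 2) ^ 2)
  set s := √(v 0 ^ 2 + v 1 ^ 2)
  have hpole : (zRot α * yRot β).1.mulVec ![0, 0, 1] =
      ![Real.cos α * Real.sin β, Real.sin α * Real.sin β, Real.cos β] := by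
    change (rotZ α * rotY β).mulVec _ = _
    ext i
    fin_cases i <;> simp [rotZ, rotY]
  rw [hpole]
  ext i
  fin_cases i
  · change r * (Real.cos α * Real.sin β) = v 0
    rw [h0, h3]
    ring
  · change r * (Real.sin α * Real.sin β) = v 1
    rw [h1, h3]
    ring
  · exact h2.symm

theorem exists_eq_mul_zRot_mul_inv (x : SO3) : ∃ (y : SO3) (t : ℝ), x = y * zRot t * y⁻¹ := by
  obtain ⟨v, hv, hxv⟩ := exists_mulVec_eq_self_of_odd_card (by decide)
    (mul_eq_one_comm.1 (transpose_mul_self x)) (det_eq_one x)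
  obtain ⟨α, β, r, rfl⟩ := exists_smul_zRot_mul_yRot_mulVec_eq v
  set y : SO3 := zRot α * yRot β
  have haxis : x.1.mulVec (y.1.mulVec ![0, 0, 1]) = y.1.mulVec ![0, 0, 1] := by
    rw [Matrix.mulVec_smul] at hxv
    exact smul_right_injective _ (left_ne_zero_of_smul hv) hxv
  have hpole : (y⁻¹ * x * y).1.mulVec ![0, 0, 1] = ![0, 0, 1] := by
    change (y.1.transpose * x.1 * y.1).mulVec _ = _
    rw [← Matrix.mulVec_mulVec, ← Matrix.mulVec_mulVec, haxis, Matrix.mulVec_mulVec,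
      transpose_mul_self, Matrix.one_mulVec]
  have hcol (i : Fin 3) : (y⁻¹ * x * y).1 i 2 = (![0, 0, 1] : Fin 3 → ℝ) i := by
    simpa [Matrix.mulVec, dotProduct, Fin.sum_univ_three] using congrFun hpole i
  obtain ⟨t, ht⟩ := eq_rotZ_of_fix (y⁻¹ * x * y) (hcol 0) (hcol 1) (hcol 2)
  refine ⟨y, t, ?_⟩
  rw [show zRot t = y⁻¹ * x * y from Subtype.ext ht.symm]
  group

/-- The class function `sin² (ω / 2)`, where `ω` is the rotation angle, so that
`trace x = 1 + 2 cos ω`. -/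
noncomputable def sinSqHalf (x : SO3) : ℝ := (3 - x.1.trace) / 4

theorem sinSqHalf_mul_comm (x y : SO3) : sinSqHalf (x * y) = sinSqHalf (y * x) := by
  unfold sinSqHalf
  rw [show (x * y).1 = x.1 * y.1 from rfl, Matrix.trace_mul_comm]
  rfl

theorem sinSqHalf_zRot (t : ℝ) : sinSqHalf (zRot t) = (1 - Real.cos t) / 2 := by
  simp only [sinSqHalf, zRot, rotZ, Matrix.trace_fin_three_of]
  ring

theorem sinSqHalf_mul_mul_inv (x y : SO3) : sinSqHalf (y * x * y⁻¹) = sinSqHalf x := by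
  rw [sinSqHalf_mul_comm, inv_mul_cancel_left]

theorem sinSqHalf_mem_Icc (x : SO3) : sinSqHalf x ∈ Set.Icc (0 : ℝ) 1 := by
  obtain ⟨y, t, rfl⟩ := exists_eq_mul_zRot_mul_inv x
  rw [sinSqHalf_mul_mul_inv, sinSqHalf_zRot]
  constructor <;> linarith [Real.cos_le_one t, Real.neg_one_le_cos t]

theorem continuous_sinSqHalf : Continuous sinSqHalf :=
  (continuous_const.sub continuous_subtype_val.matrix_trace).div_const _

/-- The polynomials `P` with `P (sin² (ω / 2)) = sin ((m + 1/2) ω) / sin (ω / 2)`, the `m`th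
character of the rotation group; the recurrence is that of the Chebyshev polynomials in
`cos ω = 1 - 2 sin² (ω / 2)`. -/
noncomputable def charPoly : ℕ → Polynomial ℝ
  | 0 => 1
  | 1 => 3 - 4 * Polynomial.X
  | m + 2 => (2 - 4 * Polynomial.X) * charPoly (m + 1) - charPoly m

theorem eval_charPoly_zero (t : ℝ) : (charPoly 0).eval t = 1 := Polynomial.eval_one

theorem eval_charPoly_one (t : ℝ) : (charPoly 1).eval t = 3 - 4 * t := by
  simp [charPoly]

theorem eval_charPoly_add_two (m : ℕ) (t : ℝ) : (charPoly (m + 2)).eval t =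
    (2 - 4 * t) * (charPoly (m + 1)).eval t - (charPoly m).eval t := by
  simp [charPoly]

theorem eval_charPoly_succ_sub (m : ℕ) {v w : ℂ} (hvw : v * w = 1) {t : ℝ}
    (ht : (t : ℂ) = (2 - v - w) / 4) :
    (((charPoly (m + 1)).eval t : ℝ) : ℂ) - ((charPoly m).eval t : ℝ) =
      v ^ (m + 1) + w ^ (m + 1) := by
  induction m using Nat.twoStepInduction with
  | zero =>
    rw [eval_charPoly_one, eval_charPoly_zero]
    push_cast
    linear_combination -4 * ht
  | one =>
    rw [eval_charPoly_add_two, eval_charPoly_one, eval_charPoly_zero]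
    push_cast
    rw [ht]
    linear_combination 2 * hvw
  | more m ih₁ ih₂ =>
    rw [eval_charPoly_add_two (m + 1)]
    nth_rw 2 [eval_charPoly_add_two]
    push_cast
    rw [ht]
    linear_combination (v + w) * ih₂ - ih₁ + (v ^ (m + 1) + w ^ (m + 1)) * hvw

theorem trace_wignerRep_zRot_succ (m : ℕ) (t : ℝ) :
    (wignerRep (m + 1) (zRot t)).trace = (wignerRep m (zRot t)).trace +
      (Complex.exp (-Complex.I * t) ^ (m + 1) + Complex.exp (Complex.I * t) ^ (m + 1)) := by
  have hsum (n : ℕ) : (wignerRep n (zRot t)).trace =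
      ∑ i ∈ Finset.range (2 * n + 1), Complex.exp (-Complex.I * (((i : ℤ) - n : ℤ) : ℂ) * t) := by
    rw [wignerRep_zRot, Matrix.trace_diagonal, Fin.sum_univ_eq_sum_range
      fun i => Complex.exp (-Complex.I * (((i : ℤ) - n : ℤ) : ℂ) * t)]
  have hshift (i : ℕ) : Complex.exp (-Complex.I * ((((i + 1 : ℕ) : ℤ) - (m + 1 : ℕ) : ℤ) : ℂ) * t) =
      Complex.exp (-Complex.I * (((i : ℤ) - m : ℤ) : ℂ) * t) := by
    push_cast
    ring_nf
  rw [hsum, hsum, show 2 * (m + 1) + 1 = 2 * m + 1 + 1 + 1 by ring, Finset.sum_range_succ,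
    Finset.sum_range_succ']
  simp only [hshift]
  rw [add_assoc, add_comm (_ ^ _), ← Complex.exp_nat_mul, ← Complex.exp_nat_mul]
  refine congrArg _ (congrArg₂ _ ?_ ?_) <;> congr 1 <;> push_cast <;> ring

theorem trace_wignerRep_zRot (m : ℕ) (t : ℝ) :
    (wignerRep m (zRot t)).trace = (((charPoly m).eval ((1 - Real.cos t) / 2) : ℝ) : ℂ) := by
  have hinv : Complex.exp (-Complex.I * t) * Complex.exp (Complex.I * t) = 1 := by
    rw [← Complex.exp_add, neg_mul, neg_add_cancel, Complex.exp_zero]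
  have hcos : (((1 - Real.cos t) / 2 : ℝ) : ℂ) =
      (2 - Complex.exp (-Complex.I * t) - Complex.exp (Complex.I * t)) / 4 := by
    push_cast
    rw [Complex.cos, neg_mul, neg_mul, mul_comm Complex.I]
    ring
  induction m with
  | zero => simp [wignerRep_zRot, eval_charPoly_zero]
  | succ m ih =>
    rw [trace_wignerRep_zRot_succ, ← eval_charPoly_succ_sub m hinv hcos, ih, add_sub_cancel]

theorem trace_wignerRep (m : ℕ) (x : SO3) :
    (wignerRep m x).trace = (((charPoly m).eval (sinSqHalf x) : ℝ) : ℂ) := by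
  obtain ⟨y, t, rfl⟩ := exists_eq_mul_zRot_mul_inv x
  rw [sinSqHalf_mul_mul_inv, sinSqHalf_zRot, ← trace_wignerRep_zRot, map_mul,
    Matrix.trace_mul_comm, ← map_mul, inv_mul_cancel_left]

/-! ### Haar measure on the rotation group -/

instance : SecondCountableTopology (Matrix (Fin 3) (Fin 3) ℝ) :=
  inferInstanceAs (SecondCountableTopology (Fin 3 → Fin 3 → ℝ))

instance : SecondCountableTopology SO3 :=
  TopologicalSpace.Subtype.secondCountableTopology _

instance : haarSO3.IsHaarMeasure := by
  unfold haarSO3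
  infer_instance

instance : IsProbabilityMeasure haarSO3 where
  measure_univ := by
    unfold haarSO3
    simpa using Measure.haarMeasure_self (G := SO3) (K₀ := ⊤)

instance : haarSO3.IsMulRightInvariant where
  map_mul_right_eq_self g := by
    have := Measure.isProbabilityMeasure_map (μ := haarSO3) (measurable_mul_const g).aemeasurable
    exact Measure.isHaarMeasure_eq_of_isProbabilityMeasure _ _

theorem isIrreducibleUnitaryRep_wignerRep (m : ℕ) : IsIrreducibleUnitaryRep (wignerRep m) where
  continuous := continuous_wignerRep m
  map_inv := wignerRep_inv m
  exists_eq_smul_one := exists_eq_smul_one_of_commute_wignerRep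

theorem integral_eval_charPoly_sinSqHalf (m : ℕ) :
    ∫ x, (charPoly m).eval (sinSqHalf x) ∂haarSO3 = if m = 0 then 1 else 0 := by
  rcases eq_or_ne m 0 with rfl | hm
  · simp only [eval_charPoly_zero, integral_const, probReal_univ, one_smul, if_true]
  · have hne : wignerRep m (zRot 1) ≠ 1 := fun h => by
      rw [wignerRep_zRot, ← Matrix.diagonal_one, Matrix.diagonal_injective.eq_iff] at h
      have heq := (congrFun h 0).trans (congrFun h ⟨m, by lia⟩).symm
      have hindex : ((0 : ℕ) : ℤ) - m = m - m := injective_exp_neg_I_mul_int heq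
      lia
    have h := (isIrreducibleUnitaryRep_wignerRep m).integral_trace_eq_zero (μ := haarSO3) hne
    simp only [trace_wignerRep, integral_complex_ofReal, Complex.ofReal_eq_zero] at h
    rw [h, if_neg hm]

/-! ### Moments of the beta distribution -/

section BetaMoments

open ProbabilityTheory

variable {α β q : ℝ}

theorem betaPDFReal_nonneg (hα : 0 < α) (hβ : 0 < β) (x : ℝ) : 0 ≤ betaPDFReal α β x := by
  by_cases h : 0 < x ∧ x < 1
  · exact (betaPDFReal_pos h.1 h.2 hα hβ).le
  · rw [betaPDFReal, if_neg h]

theorem integral_betaPDFReal (hα : 0 < α) (hβ : 0 < β) : ∫ x, betaPDFReal α β x = 1 := by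
  rw [integral_eq_lintegral_of_nonneg_ae (ae_of_all _ (betaPDFReal_nonneg hα hβ))
    (measurable_betaPDFReal α β).aestronglyMeasurable]
  exact congrArg ENNReal.toReal (lintegral_betaPDF_eq_one hα hβ)

theorem measurable_betaPDF (α β : ℝ) : Measurable (betaPDF α β) :=
  (measurable_betaPDFReal α β).ennreal_ofReal

theorem ae_betaMeasure_mem_Ioo (α β : ℝ) : ∀ᵐ x ∂betaMeasure α β, x ∈ Set.Ioo (0 : ℝ) 1 := by
  rw [betaMeasure, ae_withDensity_iff (measurable_betaPDF α β)]
  refine ae_of_all _ fun x hx => ?_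
  by_contra h
  exact hx (by rw [betaPDF_eq, if_neg (show ¬(0 < x ∧ x < 1) from h), ENNReal.ofReal_zero])

theorem betaPDF_toReal_smul_rpow (hα : 0 < α) (hβ : 0 < β) (hq : 0 < α + q) (x : ℝ) :
    (betaPDF α β x).toReal • x ^ q =
      beta (α + q) β / beta α β * betaPDFReal (α + q) β x := by
  rw [betaPDF, ENNReal.toReal_ofReal (betaPDFReal_nonneg hα hβ x), smul_eq_mul]
  by_cases h : 0 < x ∧ x < 1
  · have hbeta := (beta_pos hα hβ).ne'
    have hbeta' := (beta_pos hq hβ).ne'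
    rw [betaPDFReal, betaPDFReal, if_pos h, if_pos h, add_sub_right_comm, Real.rpow_add h.1]
    field_simp
  · rw [betaPDFReal, betaPDFReal, if_neg h, if_neg h, zero_mul, mul_zero]

theorem integrable_rpow_betaMeasure (hα : 0 < α) (hβ : 0 < β) (hq : 0 < α + q) :
    Integrable (fun x => x ^ q) (betaMeasure α β) := by
  rw [betaMeasure, integrable_withDensity_iff_integrable_smul'
    (measurable_betaPDF α β) (ae_of_all _ fun _ => ENNReal.ofReal_lt_top)]
  simp_rw [betaPDF_toReal_smul_rpow hα hβ hq]
  exact (integrable_of_integral_eq_one (integral_betaPDFReal hq hβ)).const_mul _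

theorem integral_rpow_betaMeasure (hα : 0 < α) (hβ : 0 < β) (hq : 0 < α + q) :
    ∫ x, x ^ q ∂betaMeasure α β = beta (α + q) β / beta α β := by
  rw [betaMeasure, integral_withDensity_eq_integral_toReal_smul
    (measurable_betaPDF α β) (ae_of_all _ fun _ => ENNReal.ofReal_lt_top)]
  simp_rw [betaPDF_toReal_smul_rpow hα hβ hq]
  rw [integral_const_mul, integral_betaPDFReal hq hβ, mul_one]

theorem integrable_rpow_mul_eval_betaMeasure (hα : 0 < α) (hβ : 0 < β) (hq : 0 < α + q)
    (P : Polynomial ℝ) : Integrable (fun x => x ^ q * P.eval x) (betaMeasure α β) := by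
  obtain ⟨C, hC⟩ := (isCompact_Icc (a := (0 : ℝ)) (b := 1)).exists_bound_of_continuousOn
    P.continuous.continuousOn
  exact (integrable_rpow_betaMeasure hα hβ hq).mul_bdd P.continuous.aestronglyMeasurable
    ((ae_betaMeasure_mem_Ioo α β).mono fun x hx => hC x (Set.Ioo_subset_Icc_self hx))

end BetaMoments

/-- The integrals of `x ^ q` against the character polynomials `charPoly m` for the beta
distribution with parameters `3 / 2` and `1 / 2`. -/
noncomputable def charMoment (m : ℕ) (q : ℝ) : ℝ :=
  2 * Real.Gamma (q + 3 / 2) / √Real.pi * ((ascPochhammer ℝ m).eval (-q) / Real.Gamma (q + 2 + m))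

theorem sqrt_pi_ne_zero : √Real.pi ≠ 0 := (Real.sqrt_pos.2 Real.pi_pos).ne'

theorem Gamma_three_div_two : Real.Gamma (3 / 2) = √Real.pi / 2 := by
  rw [show (3 / 2 : ℝ) = 1 / 2 + 1 by norm_num, Real.Gamma_add_one (by norm_num),
    Real.Gamma_one_half_eq]
  ring

theorem charMoment_zero_right (m : ℕ) : charMoment m 0 = if m = 0 then 1 else 0 := by
  cases m with
  | zero => simp [charMoment, Gamma_three_div_two, sqrt_pi_ne_zero, mul_div_cancel₀]
  | succ m => simp [charMoment]

theorem charMoment_eq_zero {m n : ℕ} (h : n < m) : charMoment m n = 0 := by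
  rw [charMoment, ascPochhammer_eval_neg_coe_nat_of_lt h, zero_div, mul_zero]

theorem charMoment_zero_add_one {q : ℝ} (hq : -(3 / 2) < q) :
    charMoment 0 (q + 1) = (q + 3 / 2) / (q + 2) * charMoment 0 q := by
  have hne : q + 2 ≠ 0 := by linarith
  simp only [charMoment, ascPochhammer_zero, Polynomial.eval_one, Nat.cast_zero, add_zero]
  rw [add_right_comm, Real.Gamma_add_one (by linarith), add_right_comm q, Real.Gamma_add_one hne]
  field_simp

theorem charMoment_succ {q : ℝ} (hq : -(3 / 2) < q) (m : ℕ) :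
    charMoment (m + 1) q = (m - q) / (q + 2 + m) * charMoment m q := by
  have hne : q + 2 + m ≠ 0 := by linarith [(m.cast_nonneg : (0 : ℝ) ≤ m)]
  simp only [charMoment, ascPochhammer_succ_eval, Nat.cast_succ]
  rw [← add_assoc, Real.Gamma_add_one hne]
  field_simp
  ring

theorem charMoment_succ_add_one {q : ℝ} (hq : -(3 / 2) < q) (m : ℕ) :
    charMoment (m + 1) (q + 1) =
      -((q + 1) * (q + 3 / 2)) / ((q + 2 + m) * (q + 3 + m)) * charMoment m q := by
  have hne : q + 2 + m ≠ 0 := by linarith [(m.cast_nonneg : (0 : ℝ) ≤ m)]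
  have hne' : q + 3 + m ≠ 0 := by linarith [(m.cast_nonneg : (0 : ℝ) ≤ m)]
  have hpoch : (ascPochhammer ℝ (m + 1)).eval (-(q + 1)) =
      -(q + 1) * (ascPochhammer ℝ m).eval (-q) := by
    simp [ascPochhammer_succ_left]
  have hGamma : Real.Gamma (q + 1 + 2 + (m + 1 : ℕ)) =
      (q + 3 + m) * ((q + 2 + m) * Real.Gamma (q + 2 + m)) := by
    rw [← Real.Gamma_add_one hne, show q + 3 + m = q + 2 + m + 1 by ring,
      ← Real.Gamma_add_one (by linarith)]
    push_cast
    ring_nf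
  simp only [charMoment]
  rw [hpoch, hGamma, add_right_comm, Real.Gamma_add_one (by linarith)]
  field_simp

theorem charMoment_one {q : ℝ} (hq : -(3 / 2) < q) :
    charMoment 1 q = 3 * charMoment 0 q - 4 * charMoment 0 (q + 1) := by
  have hne : q + 2 ≠ 0 := by linarith
  have hsucc := charMoment_succ hq 0
  rw [zero_add, Nat.cast_zero, add_zero] at hsucc
  rw [hsucc, charMoment_zero_add_one hq]
  field_simp
  ring

theorem charMoment_add_two {q : ℝ} (hq : -(3 / 2) < q) (m : ℕ) :
    charMoment (m + 2) q =
      2 * charMoment (m + 1) q - 4 * charMoment (m + 1) (q + 1) - charMoment m q := by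
  have hne : q + 2 + m ≠ 0 := by linarith [(m.cast_nonneg : (0 : ℝ) ≤ m)]
  have hne' : q + 3 + m ≠ 0 := by linarith [(m.cast_nonneg : (0 : ℝ) ≤ m)]
  rw [charMoment_succ hq (m + 1), charMoment_succ_add_one hq, charMoment_succ hq, Nat.cast_succ,
    show q + 2 + ((m : ℝ) + 1) = q + 3 + m by ring]
  field_simp
  ring

section

open ProbabilityTheory

theorem integral_rpow_betaMeasure_three_halves {q : ℝ} (hq : -(3 / 2) < q) :
    ∫ x, x ^ q ∂betaMeasure (3 / 2) (1 / 2) = charMoment 0 q := by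
  have hpi := sqrt_pi_ne_zero
  have hGamma : Real.Gamma (q + 2) ≠ 0 := (Real.Gamma_pos_of_pos (by linarith)).ne'
  rw [integral_rpow_betaMeasure (by norm_num) (by norm_num) (by linarith), beta, beta, charMoment,
    show 3 / 2 + q + 1 / 2 = q + 2 by ring, add_comm (3 / 2) q,
    show (3 / 2 + 1 / 2 : ℝ) = 2 by norm_num, Real.Gamma_two, Gamma_three_div_two,
    Real.Gamma_one_half_eq, ascPochhammer_zero, Polynomial.eval_one, Nat.cast_zero, add_zero]
  field_simp

theorem integrable_rpow_mul_eval_betaMeasure_three_halves {q : ℝ} (hq : -(3 / 2) < q)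
    (P : Polynomial ℝ) :
    Integrable (fun x => x ^ q * P.eval x) (betaMeasure (3 / 2) (1 / 2)) :=
  integrable_rpow_mul_eval_betaMeasure (by norm_num) (by norm_num) (by linarith) P

theorem integral_rpow_mul_charPoly_betaMeasure {q : ℝ} (hq : -(3 / 2) < q) (m : ℕ) :
    ∫ x, x ^ q * (charPoly m).eval x ∂betaMeasure (3 / 2) (1 / 2) = charMoment m q := by
  have hint (m : ℕ) {r : ℝ} (hr : -(3 / 2) < r) :=
    integrable_rpow_mul_eval_betaMeasure_three_halves hr (charPoly m)
  have hzero {r : ℝ} (hr : -(3 / 2) < r) :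
      ∫ x, x ^ r * (charPoly 0).eval x ∂betaMeasure (3 / 2) (1 / 2) = charMoment 0 r := by
    simp only [eval_charPoly_zero, mul_one, integral_rpow_betaMeasure_three_halves hr]
  induction m using Nat.twoStepInduction generalizing q with
  | zero => exact hzero hq
  | one =>
    have hq' : -(3 / 2) < q + 1 := by linarith
    rw [charMoment_one hq, ← hzero hq, ← hzero hq', ← integral_const_mul, ← integral_const_mul,
      ← integral_sub ((hint 0 hq).const_mul 3) ((hint 0 hq').const_mul 4)]
    refine integral_congr_ae ?_
    filter_upwards [ae_betaMeasure_mem_Ioo _ _] with x hx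
    rw [Real.rpow_add hx.1, Real.rpow_one, eval_charPoly_one, eval_charPoly_zero]
    ring
  | more m ih ih' =>
    have hq' : -(3 / 2) < q + 1 := by linarith
    have hint₂ := (hint (m + 1) hq).const_mul 2
    have hint₄ := (hint (m + 1) hq').const_mul 4
    have hsub : Integrable (fun x => 2 * (x ^ q * (charPoly (m + 1)).eval x) -
        4 * (x ^ (q + 1) * (charPoly (m + 1)).eval x)) (betaMeasure (3 / 2) (1 / 2)) :=
      hint₂.sub hint₄
    rw [charMoment_add_two hq, ← ih hq, ← ih' hq, ← ih' hq', ← integral_const_mul,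
      ← integral_const_mul, ← integral_sub hint₂ hint₄, ← integral_sub hsub (hint m hq)]
    refine integral_congr_ae ?_
    filter_upwards [ae_betaMeasure_mem_Ioo _ _] with x hx
    rw [Real.rpow_add hx.1, Real.rpow_one, eval_charPoly_add_two]
    ring

end

/-! ### Measures determined by their moments -/

section Moments

variable {a b : ℝ} {μ ν : Measure ℝ} [IsFiniteMeasure μ] [IsFiniteMeasure ν]

theorem integrable_eval_of_ae_mem_Icc (hμ : ∀ᵐ x ∂μ, x ∈ Set.Icc a b) (P : Polynomial ℝ) :
    Integrable (fun x => P.eval x) μ := by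
  obtain ⟨C, hC⟩ := isCompact_Icc.exists_bound_of_continuousOn
    (P.continuous.continuousOn (s := Set.Icc a b))
  exact Integrable.of_bound P.continuous.aestronglyMeasurable C (hμ.mono fun x hx => hC x hx)

open BoundedContinuousFunction in
theorem abs_integral_eval_sub_integral_le (hμ : ∀ᵐ x ∂μ, x ∈ Set.Icc a b) (f : ℝ →ᵇ ℝ)
    {P : Polynomial ℝ} {ε : ℝ} (hP : ∀ x ∈ Set.Icc a b, |P.eval x - f x| < ε) :
    |∫ x, P.eval x ∂μ - ∫ x, f x ∂μ| ≤ ε * μ.real Set.univ := by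
  rw [← integral_sub (integrable_eval_of_ae_mem_Icc hμ P) (f.integrable μ)]
  simpa only [Real.norm_eq_abs] using norm_integral_le_of_norm_le_const
    (f := fun x => P.eval x - f x) (hμ.mono fun x hx => (hP x hx).le)

theorem measure_ext_of_integral_eval_eq (hμ : ∀ᵐ x ∂μ, x ∈ Set.Icc a b)
    (hν : ∀ᵐ x ∂ν, x ∈ Set.Icc a b)
    (h : ∀ P : Polynomial ℝ, ∫ x, P.eval x ∂μ = ∫ x, P.eval x ∂ν) : μ = ν := by
  refine ext_of_forall_integral_eq_of_IsFiniteMeasure fun f => eq_of_forall_dist_le fun ε hε => ?_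
  have hmass : 0 < μ.real Set.univ + ν.real Set.univ + 1 := by positivity
  obtain ⟨P, hP⟩ := exists_polynomial_near_of_continuousOn a b f f.continuous.continuousOn _
    (div_pos hε hmass)
  have hPμ := abs_integral_eval_sub_integral_le hμ f hP
  have hPν := abs_integral_eval_sub_integral_le hν f hP
  rw [← h P] at hPν
  calc dist (∫ x, f x ∂μ) (∫ x, f x ∂ν)
    _ ≤ |∫ x, P.eval x ∂μ - ∫ x, f x ∂μ| + |∫ x, P.eval x ∂μ - ∫ x, f x ∂ν| :=
      dist_triangle_left _ _ _
    _ ≤ ε / (μ.real Set.univ + ν.real Set.univ + 1) * (μ.real Set.univ + ν.real Set.univ + 1) := by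
      have := div_pos hε hmass
      linarith
    _ = ε := div_mul_cancel₀ ε hmass.ne'

theorem measure_ext_of_integral_eval_eq_of_span_eq_top {ι : Type*} {P : ι → Polynomial ℝ}
    (hP : Submodule.span ℝ (Set.range P) = ⊤) (hμ : ∀ᵐ x ∂μ, x ∈ Set.Icc a b)
    (hν : ∀ᵐ x ∂ν, x ∈ Set.Icc a b)
    (h : ∀ i, ∫ x, (P i).eval x ∂μ = ∫ x, (P i).eval x ∂ν) : μ = ν := by
  refine measure_ext_of_integral_eval_eq hμ hν fun Q => ?_
  induction hP ▸ Submodule.mem_top (x := Q) using Submodule.span_induction with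
  | mem _ hQ =>
    obtain ⟨i, rfl⟩ := hQ
    exact h i
  | zero => simp only [Polynomial.eval_zero, integral_zero]
  | add Q R _ _ hQ hR =>
    simp only [Polynomial.eval_add]
    rw [integral_add (integrable_eval_of_ae_mem_Icc hμ Q) (integrable_eval_of_ae_mem_Icc hμ R),
      integral_add (integrable_eval_of_ae_mem_Icc hν Q) (integrable_eval_of_ae_mem_Icc hν R),
      hQ, hR]
  | smul c Q _ hQ =>
    simp only [Polynomial.eval_smul, smul_eq_mul, integral_const_mul, hQ]

end Moments

theorem degree_charPoly (m : ℕ) : (charPoly m).degree = m := by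
  induction m using Nat.twoStepInduction with
  | zero => exact Polynomial.degree_one
  | one =>
    rw [charPoly]
    compute_degree!
  | more m ih ih' =>
    have hlin : (2 - 4 * Polynomial.X : Polynomial ℝ).degree = 1 := by compute_degree!
    have hmul : ((2 - 4 * Polynomial.X) * charPoly (m + 1)).degree =
        ((m + 2 : ℕ) : WithBot ℕ) := by
      rw [Polynomial.degree_mul, hlin, ih', ← Nat.cast_one, ← Nat.cast_add, add_comm 1]
    rw [charPoly, Polynomial.degree_sub_eq_left_of_degree_lt, hmul]
    rw [hmul, ih, Nat.cast_lt]
    omega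

theorem span_charPoly : Submodule.span ℝ (Set.range charPoly) = ⊤ :=
  Polynomial.Sequence.span ⟨charPoly, degree_charPoly⟩ fun m => isUnit_iff_ne_zero.2
    (Polynomial.leadingCoeff_ne_zero.2 (Polynomial.Sequence.ne_zero ⟨charPoly, degree_charPoly⟩ m))

section

open ProbabilityTheory

theorem map_sinSqHalf : Measure.map sinSqHalf haarSO3 = betaMeasure (3 / 2) (1 / 2) := by
  have hmeas := continuous_sinSqHalf.measurable.aemeasurable (μ := haarSO3)
  have := isProbabilityMeasureBeta (α := 3 / 2) (β := 1 / 2) (by norm_num) (by norm_num)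
  refine measure_ext_of_integral_eval_eq_of_span_eq_top span_charPoly
    ((ae_map_iff hmeas measurableSet_Icc).2 (ae_of_all _ sinSqHalf_mem_Icc))
    ((ae_betaMeasure_mem_Ioo _ _).mono fun _ => (Set.Ioo_subset_Icc_self ·)) fun m => ?_
  have hbeta := integral_rpow_mul_charPoly_betaMeasure (q := 0) (by norm_num) m
  simp only [Real.rpow_zero, one_mul] at hbeta
  rw [integral_map hmeas (charPoly m).continuous.aestronglyMeasurable,
    integral_eval_charPoly_sinSqHalf, hbeta, charMoment_zero_right]

theorem integrable_sinSqHalf_rpow {q : ℝ} (hq : -(3 / 2) < q) :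
    Integrable (fun x => sinSqHalf x ^ q) haarSO3 := by
  have hbeta := integrable_rpow_betaMeasure (α := 3 / 2) (β := 1 / 2) (q := q) (by norm_num)
    (by norm_num) (by linarith)
  rw [← map_sinSqHalf] at hbeta
  exact hbeta.comp_measurable continuous_sinSqHalf.measurable

end

theorem integral_sinSqHalf_rpow_mul_charPoly {q : ℝ} (hq : -(3 / 2) < q) (m : ℕ) :
    ∫ x, sinSqHalf x ^ q * (charPoly m).eval (sinSqHalf x) ∂haarSO3 = charMoment m q := by
  have hmeas : Measurable fun t : ℝ => t ^ q * (charPoly m).eval t :=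
    (measurable_id.pow_const q).mul (charPoly m).continuous.measurable
  rw [← integral_rpow_mul_charPoly_betaMeasure hq m, ← map_sinSqHalf,
    integral_map continuous_sinSqHalf.measurable.aemeasurable hmeas.aestronglyMeasurable]

/-! ### The Fourier coefficients of the kernel -/

theorem four_mul_mul_sum_charMoment_mul_eval {q : ℝ} (hq : -(3 / 2) < q) (x : ℝ) (N : ℕ) :
    4 * x * ∑ m ∈ Finset.range (N + 1), charMoment m q * (charPoly m).eval x =
      4 * ∑ m ∈ Finset.range (N + 1), charMoment m (q + 1) * (charPoly m).eval x +
        charMoment (N + 1) q * (charPoly N).eval x -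
        charMoment N q * (charPoly (N + 1)).eval x := by
  induction N with
  | zero =>
    simp only [zero_add, Finset.sum_range_one, eval_charPoly_zero, eval_charPoly_one]
    linear_combination -charMoment_one hq
  | succ N ih =>
    rw [Finset.sum_range_succ, mul_add, ih, Finset.sum_range_succ _ (N + 1), eval_charPoly_add_two]
    linear_combination -(charPoly (N + 1)).eval x * charMoment_add_two hq N

theorem pow_eq_sum_charMoment_mul_eval {n N : ℕ} (hnN : n < N) (x : ℝ) :
    x ^ n = ∑ m ∈ Finset.range N, charMoment m n * (charPoly m).eval x := by
  induction n generalizing N with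
  | zero =>
    simp only [Nat.cast_zero, charMoment_zero_right, ite_mul, zero_mul, Finset.sum_ite_eq',
      Finset.mem_range, if_pos hnN, eval_charPoly_zero, pow_zero, mul_one]
  | succ n ih =>
    obtain ⟨M, rfl⟩ := Nat.exists_eq_add_one.2 (Nat.zero_lt_of_lt hnN)
    have hn : -(3 / 2) < (n : ℝ) := by linarith [n.cast_nonneg (α := ℝ)]
    have hsum := four_mul_mul_sum_charMoment_mul_eval hn x M
    rw [charMoment_eq_zero (by omega), charMoment_eq_zero (by omega), ← ih (by omega)] at hsum
    rw [pow_succ, Nat.cast_succ]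
    linarith

theorem sinSqHalf_inv (x : SO3) : sinSqHalf x⁻¹ = sinSqHalf x := by
  rw [sinSqHalf, sinSqHalf, show (x⁻¹).1 = x.1.transpose from rfl, Matrix.trace_transpose]

/-- The central function on the rotation group with values `2 ^ p * |sin (ω / 2)| ^ p` on rotations
by the angle `ω`; it generates the kernel by `kernel p x y = zonalKernel p (x⁻¹ * y)`. -/
noncomputable def zonalKernel (p : ℝ) (x : SO3) : ℝ :=
  (2 : ℝ) ^ p * sinSqHalf x ^ (p / 2)

theorem trace_transpose_sub_mul_sub (x y : SO3) :
    ((x.1 - y.1).transpose * (x.1 - y.1)).trace = 8 * sinSqHalf (x⁻¹ * y) := by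
  have hinv : (x⁻¹ * y).1 = x.1.transpose * y.1 := rfl
  have hswap : (y.1.transpose * x.1).trace = (x.1.transpose * y.1).trace := by
    rw [← Matrix.trace_transpose, Matrix.transpose_mul, Matrix.transpose_transpose]
  rw [sinSqHalf, hinv, Matrix.transpose_sub, sub_mul, mul_sub, mul_sub, transpose_mul_self,
    transpose_mul_self, Matrix.trace_sub, Matrix.trace_sub, Matrix.trace_sub, hswap,
    Matrix.trace_one, Fintype.card_fin, Nat.cast_ofNat]
  ring

theorem kernel_eq_zonalKernel (p : ℝ) (x y : SO3) : kernel p x y = zonalKernel p (x⁻¹ * y) := by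
  have hpow : (8 : ℝ) ^ (p / 2) = (2 : ℝ) ^ (3 * (p / 2)) := by
    rw [Real.rpow_mul (by norm_num)]
    norm_num
  rw [kernel, zonalKernel, frobeniusNorm, trace_transpose_sub_mul_sub, Real.sqrt_eq_rpow,
    ← Real.rpow_mul (mul_nonneg (by norm_num) (sinSqHalf_mem_Icc _).1),
    one_div_mul_eq_div, Real.mul_rpow (by norm_num) (sinSqHalf_mem_Icc _).1, ← mul_assoc, hpow,
    ← Real.rpow_add (by norm_num)]
  ring_nf

theorem integrable_zonalKernel {p : ℝ} (hp : -3 < p) :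
    Integrable (fun x => (zonalKernel p x : ℂ)) haarSO3 :=
  ((integrable_sinSqHalf_rpow (by linarith)).const_mul _).ofReal

theorem integral_zonalKernel_mul_trace_wignerRep {p : ℝ} (hp : -3 < p) (m : ℕ) :
    ∫ x, (zonalKernel p x : ℂ) * (wignerRep m x).trace ∂haarSO3 =
      (((2 : ℝ) ^ p * charMoment m (p / 2) : ℝ) : ℂ) := by
  simp_rw [trace_wignerRep, ← Complex.ofReal_mul, integral_complex_ofReal, zonalKernel, mul_assoc]
  rw [integral_const_mul, integral_sinSqHalf_rpow_mul_charPoly (by linarith)]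

theorem exists_fin_sub_eq {m : ℕ} {k : ℤ} (hk : |k| ≤ m) :
    ∃ i : Fin (2 * m + 1), (i : ℤ) - m = k := by
  rw [abs_le] at hk
  exact ⟨⟨(k + m).toNat, by omega⟩, by simp only; omega⟩

theorem sum_Icc_eq_sum_fin {M : Type*} [AddCommMonoid M] (m : ℕ) (g : ℤ → M) :
    ∑ k ∈ Finset.Icc (-(m : ℤ)) m, g k = ∑ i : Fin (2 * m + 1), g ((i : ℤ) - m) := by
  symm
  refine Finset.sum_bij (fun i _ => (i : ℤ) - m) (fun i _ => ?_) (fun i _ j _ hij => ?_)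
    (fun k hk => ?_) fun _ _ => rfl
  · rw [Finset.mem_Icc]
    omega
  · omega
  · obtain ⟨i, hi⟩ := exists_fin_sub_eq (abs_le.2 (Finset.mem_Icc.1 hk))
    exact ⟨i, Finset.mem_univ i, hi⟩

theorem ofReal_sqrt_mul_ofReal_sqrt (m : ℕ) :
    ((√(2 * m + 1) : ℝ) : ℂ) * ((√(2 * m + 1) : ℝ) : ℂ) = 2 * m + 1 := by
  rw [← Complex.ofReal_mul, Real.mul_self_sqrt (by positivity)]
  push_cast
  rfl

theorem two_mul_add_one_ne_zero (m : ℕ) : (2 * m + 1 : ℂ) ≠ 0 := by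
  exact_mod_cast (2 * m).succ_ne_zero

/-- The coefficients of the kernel `2 ^ (-p / 2) * ‖x - y‖ ^ p` with respect to the Wigner
functions of degree `m`. -/
noncomputable def kernelCoeff (p : ℝ) (m : ℕ) : ℝ :=
  (2 : ℝ) ^ p * charMoment m (p / 2) / (2 * m + 1)

theorem coeffIntegrand_eq (p : ℝ) (m : ℕ) (i j : Fin (2 * m + 1)) :
    coeffIntegrand p m ((i : ℤ) - m) ((j : ℤ) - m) = fun z => (2 * m + 1 : ℂ) *
      (zonalKernel p (z.1⁻¹ * z.2) * star (wignerRep m z.1 i j) * wignerRep m z.2 i j) := by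
  ext z
  rw [coeffIntegrand, kernel_eq_zonalKernel, wignerD_eq_wignerRep, wignerD_eq_wignerRep, map_mul,
    Complex.conj_ofReal, ← ofReal_sqrt_mul_ofReal_sqrt, starRingEnd_apply]
  ring

theorem integrable_coeffIntegrand {p : ℝ} (hp : -3 < p) {m : ℕ} {k l : ℤ} (hk : |k| ≤ m)
    (hl : |l| ≤ m) : Integrable (coeffIntegrand p m k l) (haarSO3.prod haarSO3) := by
  obtain ⟨i, rfl⟩ := exists_fin_sub_eq hk
  obtain ⟨j, rfl⟩ := exists_fin_sub_eq hl
  rw [coeffIntegrand_eq]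
  exact ((isIrreducibleUnitaryRep_wignerRep m).integrable_convolution
    (integrable_zonalKernel hp) i j).const_mul _

theorem wignerCoeff_eq_kernelCoeff {p : ℝ} (hp : -3 < p) {m : ℕ} {k l : ℤ} (hk : |k| ≤ m)
    (hl : |l| ≤ m) : wignerCoeff p m k l = kernelCoeff p m := by
  obtain ⟨i, rfl⟩ := exists_fin_sub_eq hk
  obtain ⟨j, rfl⟩ := exists_fin_sub_eq hl
  have hcentral (x y : SO3) : (zonalKernel p (x * y) : ℂ) = zonalKernel p (y * x) := by
    rw [zonalKernel, zonalKernel, sinSqHalf_mul_comm]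
  have hm := two_mul_add_one_ne_zero m
  rw [wignerCoeff, coeffIntegrand_eq, integral_const_mul,
    (isIrreducibleUnitaryRep_wignerRep m).integral_convolution_of_central
      (integrable_zonalKernel hp) hcentral i j,
    integral_zonalKernel_mul_trace_wignerRep hp, Fintype.card_fin, kernelCoeff]
  push_cast
  field_simp

theorem sum_wignerD_mul_conj (m : ℕ) (x y : SO3) :
    ∑ k ∈ Finset.Icc (-(m : ℤ)) m, ∑ l ∈ Finset.Icc (-(m : ℤ)) m,
        wignerD m k l x * (starRingEnd ℂ) (wignerD m k l y) =
      (2 * m + 1) * (((charPoly m).eval (sinSqHalf (x⁻¹ * y)) : ℝ) : ℂ) := by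
  have hangle : sinSqHalf (x⁻¹ * y) = sinSqHalf (x * y⁻¹) := by
    rw [sinSqHalf_mul_comm, ← sinSqHalf_inv, mul_inv_rev, inv_inv]
  rw [hangle, ← trace_wignerRep, map_mul, wignerRep_inv, Matrix.trace, Finset.mul_sum]
  simp only [sum_Icc_eq_sum_fin, wignerD_eq_wignerRep, map_mul, Complex.conj_ofReal,
    Matrix.diag_apply, Matrix.mul_apply, Matrix.conjTranspose_apply, Finset.mul_sum,
    ← ofReal_sqrt_mul_ofReal_sqrt]
  exact Finset.sum_congr rfl fun i _ => Finset.sum_congr rfl fun j _ => mul_mul_mul_comm _ _ _ _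

theorem kernel_two_mul_natCast (n : ℕ) (x y : SO3) : (kernel (2 * n) x y : ℂ) =
    ∑ m ∈ Finset.range (n + 1), (kernelCoeff (2 * n) m : ℂ) *
      ∑ k ∈ Finset.Icc (-(m : ℤ)) m, ∑ l ∈ Finset.Icc (-(m : ℤ)) m,
        wignerD m k l x * (starRingEnd ℂ) (wignerD m k l y) := by
  rw [kernel_eq_zonalKernel, zonalKernel, mul_div_cancel_left₀ _ two_ne_zero, Real.rpow_natCast,
    pow_eq_sum_charMoment_mul_eval n.lt_succ_self, Finset.mul_sum, Complex.ofReal_sum]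
  refine Finset.sum_congr rfl fun m _ => ?_
  have hm := two_mul_add_one_ne_zero m
  rw [sum_wignerD_mul_conj, kernelCoeff, mul_div_cancel_left₀ _ two_ne_zero]
  push_cast
  field_simp

theorem kernelCoeff_two_mul_natCast_eq_zero {n m : ℕ} (h : n < m) : kernelCoeff (2 * n) m = 0 := by
  rw [kernelCoeff, mul_div_cancel_left₀ _ two_ne_zero, charMoment_eq_zero h, mul_zero, zero_div]

theorem kernelCoeff_eq (p : ℝ) (m : ℕ) :
    kernelCoeff p m = (2 : ℝ) ^ p * Real.Gamma (p / 2 + 3 / 2) / √Real.pi *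
      ((ascPochhammer ℝ m).eval (-p / 2) / Real.Gamma (p / 2 + 2 + m)) * (1 / (m + 1 / 2)) := by
  have hm : (m : ℝ) + 1 / 2 ≠ 0 := by positivity
  rw [kernelCoeff, charMoment, neg_div, show (2 * m + 1 : ℝ) = 2 * (m + 1 / 2) by ring]
  field_simp

/-! ### Asymptotics of ratios of Gamma functions -/

theorem ascPochhammer_eval_eq_prod_range {S : Type*} [CommSemiring S] (n : ℕ) (r : S) :
    (ascPochhammer S n).eval r = ∏ j ∈ Finset.range n, (r + j) := by
  induction n with
  | zero => rw [ascPochhammer_zero, Polynomial.eval_one, Finset.prod_range_zero]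
  | succ n ih => rw [ascPochhammer_succ_eval, ih, Finset.prod_range_succ]

theorem Gamma_add_natCast {s : ℝ} (hs : ∀ n : ℕ, s ≠ -n) (m : ℕ) :
    Real.Gamma (s + m) = (ascPochhammer ℝ m).eval s * Real.Gamma s := by
  induction m with
  | zero => simp
  | succ m ih =>
    rw [ascPochhammer_succ_eval, mul_right_comm, ← ih, Nat.cast_succ, ← add_assoc,
      Real.Gamma_add_one fun h => hs m (eq_neg_of_add_eq_zero_left h), mul_comm]

theorem tendsto_Gamma_add_succ_div {s : ℝ} (hs : ∀ n : ℕ, s ≠ -n) :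
    Tendsto (fun m : ℕ => Real.Gamma (s + (m + 1 : ℕ)) / ((m : ℝ) ^ s * m.factorial))
      atTop (𝓝 1) := by
  have hGamma := Real.Gamma_ne_zero hs
  have hlim := (Real.GammaSeq_tendsto_Gamma s).inv₀ hGamma |>.const_mul (Real.Gamma s)
  rw [mul_inv_cancel₀ hGamma] at hlim
  refine hlim.congr fun m => ?_
  rw [Gamma_add_natCast hs, ascPochhammer_eval_eq_prod_range, Real.GammaSeq, inv_div,
    mul_comm, div_mul_eq_mul_div]

theorem tendsto_add_natCast_div_add_natCast (a b : ℝ) :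
    Tendsto (fun m : ℕ => (a + m) / (b + m)) atTop (𝓝 1) := by
  simpa only [one_mul, div_one] using
    tendsto_add_mul_div_add_mul_atTop_nhds a b (1 : ℝ) one_ne_zero

theorem tendsto_Gamma_add_div_Gamma_add {a b : ℝ} (ha : ∀ n : ℕ, a ≠ -n) (hb : ∀ n : ℕ, b ≠ -n) :
    Tendsto (fun m : ℕ => Real.Gamma (a + m) / Real.Gamma (b + m) * (m : ℝ) ^ (b - a))
      atTop (𝓝 1) := by
  have hlim := ((tendsto_Gamma_add_succ_div ha).div (tendsto_Gamma_add_succ_div hb)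
    one_ne_zero).mul (tendsto_add_natCast_div_add_natCast b a)
  rw [div_one, mul_one] at hlim
  refine hlim.congr' ?_
  filter_upwards [eventually_gt_atTop 0] with m hm
  have hm : (0 : ℝ) < m := Nat.cast_pos.2 hm
  have ham : a + m ≠ 0 := fun h => ha m (eq_neg_of_add_eq_zero_left h)
  have hbm : b + m ≠ 0 := fun h => hb m (eq_neg_of_add_eq_zero_left h)
  have hfactorial : (m.factorial : ℝ) ≠ 0 := Nat.cast_ne_zero.2 m.factorial_ne_zero
  have hpow := (Real.rpow_pos_of_pos hm a).ne'
  have hpow' := (Real.rpow_pos_of_pos hm b).ne'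
  rw [Pi.div_apply, Nat.cast_succ, ← add_assoc, ← add_assoc, Real.Gamma_add_one ham,
    Real.Gamma_add_one hbm, Real.rpow_sub hm]
  field_simp

theorem kernelCoeff_eq_Gamma {p : ℝ} (hp : ∀ n : ℕ, p ≠ 2 * n) (m : ℕ) :
    kernelCoeff p m =
      (2 : ℝ) ^ p * Real.Gamma (p / 2 + 3 / 2) / (√Real.pi * Real.Gamma (-p / 2)) *
        (Real.Gamma (-p / 2 + m) / Real.Gamma (p / 2 + 2 + m)) * (1 / (m + 1 / 2)) := by
  have hpole : ∀ n : ℕ, -p / 2 ≠ -n := fun n h => hp n (by linarith)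
  have hGamma := Real.Gamma_ne_zero hpole
  rw [kernelCoeff_eq, Gamma_add_natCast hpole]
  generalize Real.Gamma (-p / 2) = G at hGamma
  field_simp

theorem kernelCoeff_asymptotics {p : ℝ} (hp : -3 < p) (hpn : ∀ n : ℕ, p ≠ 2 * n) :
    ∃ ε : ℕ → ℝ, Tendsto ε atTop (𝓝 0) ∧ ∀ m : ℕ, 1 ≤ m →
      |kernelCoeff p m| =
        |(2 : ℝ) ^ p * Real.Gamma (p / 2 + 3 / 2) / (√Real.pi * Real.Gamma (-p / 2))| *
          (m : ℝ) ^ (-(p + 3)) * (1 + ε m) := by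
  have hpole : ∀ n : ℕ, -p / 2 ≠ -n := fun n h => hpn n (by linarith)
  have hpole' : ∀ n : ℕ, p / 2 + 2 ≠ -n := fun n h => by linarith [n.cast_nonneg (α := ℝ)]
  have hlim := ((tendsto_Gamma_add_div_Gamma_add hpole hpole').mul
    (tendsto_add_natCast_div_add_natCast 0 (1 / 2))).abs.sub_const 1
  rw [mul_one, abs_one, sub_self, show p / 2 + 2 - -p / 2 = p + 2 by ring] at hlim
  refine ⟨_, hlim, fun m hm => ?_⟩
  have hm : (0 : ℝ) < m := Nat.cast_pos.2 hm
  have hpow := (Real.rpow_pos_of_pos hm (p + 2)).ne'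
  have hsplit : (m : ℝ) ^ (-(p + 3)) = ((m : ℝ) ^ (p + 2) * m)⁻¹ := by
    rw [Real.rpow_neg hm.le, ← Real.rpow_add_one hm.ne', add_assoc]
    norm_num
  rw [kernelCoeff_eq_Gamma hpn, add_sub_cancel, zero_add, add_comm (1 / 2) (m : ℝ),
    ← abs_of_nonneg (Real.rpow_nonneg hm.le (-(p + 3))), ← abs_mul, ← abs_mul, hsplit]
  generalize (2 : ℝ) ^ p * Real.Gamma (p / 2 + 3 / 2) / (√Real.pi * Real.Gamma (-p / 2)) = C
  congr 1
  field_simp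

end WignerSO3

open WignerSO3

theorem mainTheorem3 (p : ℝ) (hp : -3 < p) :
    ∃ a : ℕ → ℝ,
      -- the integrals exist, and their values `a m` do not depend on `k, l`
      (∀ (m : ℕ) (k l : ℤ), |k| ≤ m → |l| ≤ m →
        Integrable (coeffIntegrand p m k l) (haarSO3.prod haarSO3) ∧
        wignerCoeff p m k l = (a m : ℂ)) ∧
      -- the formula, with `Γ(-p/2+m)/Γ(-p/2)` read as the Pochhammer symbol `(-p/2)_m`
      (∀ m : ℕ, a m = (2 : ℝ) ^ p * Real.Gamma (p / 2 + 3 / 2) / Real.sqrt Real.pi *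
        ((ascPochhammer ℝ m).eval (-p / 2) / Real.Gamma (p / 2 + 2 + m)) * (1 / (m + 1 / 2))) ∧
      -- the formula and the asymptotics for `p ∉ 2ℕ`
      ((∀ n : ℕ, p ≠ 2 * n) →
        (∀ m : ℕ, a m =
          (2 : ℝ) ^ p * Real.Gamma (p / 2 + 3 / 2) / (Real.sqrt Real.pi * Real.Gamma (-p / 2)) *
          (Real.Gamma (-p / 2 + m) / Real.Gamma (p / 2 + 2 + m)) * (1 / (m + 1 / 2))) ∧
        ∃ ε : ℕ → ℝ, Tendsto ε atTop (𝓝 0) ∧ ∀ m : ℕ, 1 ≤ m →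
          |a m| =
            |(2 : ℝ) ^ p * Real.Gamma (p / 2 + 3 / 2) /
              (Real.sqrt Real.pi * Real.Gamma (-p / 2))| * (m : ℝ) ^ (-(p + 3)) * (1 + ε m)) ∧
      -- the series terminates for `p ∈ 2ℕ`
      (∀ n : ℕ, p = 2 * n →
        (∀ m : ℕ, n < m → a m = 0) ∧
        ∀ x y : SO3, (kernel p x y : ℂ) =
          ∑ m ∈ Finset.range (n + 1), (a m : ℂ) *
            ∑ k ∈ Finset.Icc (-(m : ℤ)) m, ∑ l ∈ Finset.Icc (-(m : ℤ)) m,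
              wignerD m k l x * (starRingEnd ℂ) (wignerD m k l y)) := by
  refine ⟨kernelCoeff p, fun m k l hk hl =>
    ⟨integrable_coeffIntegrand hp hk hl, wignerCoeff_eq_kernelCoeff hp hk hl⟩, kernelCoeff_eq p,
    fun hpn => ⟨kernelCoeff_eq_Gamma hpn, kernelCoeff_asymptotics hp hpn⟩, ?_⟩
  rintro n rfl
  exact ⟨fun m => kernelCoeff_two_mul_natCast_eq_zero, kernel_two_mul_natCast n⟩
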